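/- Let $\mathscr K$ be the set of classical oriented knots, that is, of oriented one-component link diagrams in the plane (with classical crossings) up to planar isotopy and Reidemeister moves. An (oriented) $n$-tangle is an oriented diagram in a disk with $2n$ fixed, enumerated boundary points, and a (monomial) local move of degree $n$ is a pair $(T,T')$ of $n$-tangles with the same oriented boundary; it is applied to a diagram $D$ that contains $T$ as its part in some disk, by replacing $T$ with $T'$. For a set $\mathcal M$ of local moves let $\mathscr K/\mathcal M$ be the quotient of $\mathscr K$ by the equivalence relation $\sim_{\mathcal M}$ generated by the pairs $(K,K')$ of knots that have knot diagrams $D$, $D'$ such that $D'$ is the result of applying a move of $\mathcal M$ to $D$. The set $\mathcal M$ is called reduced if all its moves have positive degree. A knot invariant $I\colon\mathscr K\to X$ is called a reduced skein invariant if there are a finite reduced set of moves $\mathcal M$ and an injection $f\colon\mathscr K/\mathcal M\to X$ such that $I=f\circ p$, where $p\colon\mathscr K\to\mathscr K/\mathcal M$ is the projection. The connected sum $K\#K'$ of two knots is the closure of the concatenation of two long knots whose closures are $K$ and $K'$. **Theorem.** Let $I\colon\mathscr K\to X$ be a reduced skein invariant with $X=I(\mathscr K)$. Then $I$ is additive: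 the connected sum $K\#K'$ exists and is unique for all $K,K'\in\mathscr K$, and there is a commutative monoid structure $+$ on $X$ such that $I(K\#K')=I(K)+I(K')$ for all $K,K'\in\mathscr K$. -/

import Mathlib

namespace SkeinKnot

/-! ## Oriented tangle diagrams in the plane

A diagram in general position with respect to the height function is read from bottom to top.
Horizontal levels that avoid crossings, maxima and minima meet it in a word of directions
(`true` is upwards, `false` is downwards), and it is a stack of slices, each of which
contains one maximum, one minimum or one crossing, next to vertical strands. -/

/-- The pieces from which diagrams are built.
* `cap a` is a local maximum, with left leg directed by `a` and right leg by `!a`;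
* `cup a` is a local minimum, with left leg directed by `a` and right leg by `!a`;
* `cross o a b` is a classical crossing of a strand of direction `a`, which occupies the bottom
  left and the top right corner, and a strand of direction `b`, which occupies the bottom right
  and the top left corner. The first of these strands is the upper one if and only if `o = true`. -/
inductive Piece : Type
  | cap (a : Bool) : Piece
  | cup (a : Bool) : Piece
  | cross (o a b : Bool) : Piece

/-- The directions of the strands at the bottom of a piece, from left to right. -/
def Piece.bottom : Piece → List Bool
  | .cap a => [a, !a]
  | .cup _ => []
  | .cross _ a b => [a, b]

/-- The directions of the strands at the top of a piece, from left to right. -/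
def Piece.top : Piece → List Bool
  | .cap _ => []
  | .cup a => [a, !a]
  | .cross _ a b => [b, a]

/-- A slice of a diagram: a piece with vertical strands to its left and to its right. -/
structure Slice : Type where
  left : List Bool
  piece : Piece
  right : List Bool

def Slice.bottom (s : Slice) : List Bool := s.left ++ s.piece.bottom ++ s.right

def Slice.top (s : Slice) : List Bool := s.left ++ s.piece.top ++ s.right

/-- `IsTangle a d b`: the slices in the list `d`, stacked from bottom to top, fit together to an
oriented tangle diagram in a rectangle, with the word `a` at the bottom and the word `b` at the
top of the rectangle. -/
def IsTangle (a : List Bool) : List Slice → List Bool → Prop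
  | [], b => a = b
  | s :: d, b => s.bottom = a ∧ IsTangle s.top d b

/-- Classical oriented tangle diagrams in a rectangle with bottom word `a` and top word `b`. -/
def Tangle (a b : List Bool) : Type := {d : List Slice // IsTangle a d b}

/-- The diagram `d` with the vertical strands `l` to its left and `r` to its right. -/
def pad (l r : List Bool) (d : List Slice) : List Slice :=
  d.map fun s => ⟨l ++ s.left, s.piece, s.right ++ r⟩

/-- `D'` is obtained from `D` when a subtangle `t` of `D` (the part of `D` in a
rectangle) is replaced by `t'`. -/
def Replace (t t' D D' : List Slice) : Prop :=
  ∃ (A B : List Slice) (l r : List Bool), D = A ++ pad l r t ++ B ∧ D' = A ++ pad l r t' ++ B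

/-! ## Planar isotopy and Reidemeister moves -/

/-- Planar isotopies: the changes that a diagram undergoes in a generic isotopy of the plane. -/
inductive PlanarMove : List Slice → List Slice → Prop
  /-- Two pieces exchange their heights. -/
  | exchange (g h : Piece) (m : List Bool) :
      PlanarMove [⟨[], g, m ++ h.bottom⟩, ⟨g.top ++ m, h, []⟩]
        [⟨g.bottom ++ m, h, []⟩, ⟨[], g, m ++ h.top⟩]
  /-- A maximum and the minimum to its right cancel. -/
  | zigzag (a : Bool) :
      PlanarMove [⟨[a], .cup (!a), []⟩, ⟨[], .cap a, [a]⟩] []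
  /-- A maximum and the minimum to its left cancel. -/
  | zagzig (a : Bool) :
      PlanarMove [⟨[], .cup a, [a]⟩, ⟨[a], .cap (!a), []⟩] []
  /-- A crossing of a strand with the right leg of a maximum moves to the left leg. -/
  | capCross (o a b : Bool) :
      PlanarMove [⟨[a], .cross o b (!a), []⟩, ⟨[], .cap a, [b]⟩]
        [⟨[], .cross (!o) a b, [!a]⟩, ⟨[b], .cap a, []⟩]
  /-- A crossing of a strand with the right leg of a minimum moves to the left leg. -/
  | cupCross (o a b : Bool) :
      PlanarMove [⟨[], .cup a, [b]⟩, ⟨[a], .cross o (!a) b, []⟩]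
        [⟨[b], .cup a, []⟩, ⟨[], .cross (!o) b a, [!a]⟩]

/-- The classical Reidemeister moves, for all orientations of the strands. -/
inductive ReidemeisterMove : List Slice → List Slice → Prop
  /-- First move, loop on the right. -/
  | oneRight (o a : Bool) :
      ReidemeisterMove
        [⟨[a], .cup a, []⟩, ⟨[], .cross o a a, [!a]⟩, ⟨[a], .cap a, []⟩] []
  /-- First move, loop on the left. -/
  | oneLeft (o a : Bool) :
      ReidemeisterMove
        [⟨[], .cup (!a), [a]⟩, ⟨[!a], .cross o a a, []⟩, ⟨[], .cap (!a), [a]⟩] []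
  /-- Second move. -/
  | two (o a b : Bool) :
      ReidemeisterMove [⟨[], .cross o a b, []⟩, ⟨[], .cross (!o) b a, []⟩] []
  /-- Third move. The numbers `o`, `p`, `q` tell which strand is the upper one at the crossings
  of the first and second, first and third, second and third strand. The hypothesis excludes
  exactly the two cyclic configurations, in which no strand is the highest. -/
  | three (o p q a b c : Bool) (h : o = q → p = o) :
      ReidemeisterMove
        [⟨[], .cross o a b, [c]⟩, ⟨[b], .cross p a c, []⟩, ⟨[], .cross q b c, [a]⟩]
        [⟨[a], .cross q b c, []⟩, ⟨[], .cross p a c, [b]⟩, ⟨[c], .cross o a b, []⟩]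

/-- One planar isotopy or Reidemeister move, applied somewhere in a diagram. -/
def Step {a b : List Bool} (D D' : Tangle a b) : Prop :=
  ∃ t t' : List Slice, (PlanarMove t t' ∨ ReidemeisterMove t t') ∧ Replace t t' D.1 D'.1

/-- Diagrams in a rectangle up to planar isotopy and Reidemeister moves. -/
def tangleSetoid (a b : List Bool) : Setoid (Tangle a b) := Relation.EqvGen.setoid Step

/-! ## Knot diagrams and knots -/

/-- A point of a diagram on a horizontal level between two slices: the slices before and after the
level, and the directions of the strands at that level, to the left of the point, at the point,
and to its right. -/
structure Point : Type where
  before : List Slice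
  left : List Bool
  dir : Bool
  right : List Bool
  after : List Slice

/-- `p` is a point of the diagram `D` without boundary. -/
def Point.On (p : Point) (D : List Slice) : Prop :=
  D = p.before ++ p.after ∧ IsTangle [] p.before (p.left ++ p.dir :: p.right)

/-- Two points are joined by an arc of the diagram that lies in a single slice. -/
inductive Point.Link : Point → Point → Prop
  | strandLeft (A B : List Slice) (l₁ l₂ r : List Bool) (a : Bool) (g : Piece) :
      Point.Link ⟨A, l₁, a, l₂ ++ g.bottom ++ r, ⟨l₁ ++ a :: l₂, g, r⟩ :: B⟩
        ⟨A ++ [⟨l₁ ++ a :: l₂, g, r⟩], l₁, a, l₂ ++ g.top ++ r, B⟩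
  | strandRight (A B : List Slice) (l r₁ r₂ : List Bool) (a : Bool) (g : Piece) :
      Point.Link ⟨A, l ++ g.bottom ++ r₁, a, r₂, ⟨l, g, r₁ ++ a :: r₂⟩ :: B⟩
        ⟨A ++ [⟨l, g, r₁ ++ a :: r₂⟩], l ++ g.top ++ r₁, a, r₂, B⟩
  | cap (A B : List Slice) (l r : List Bool) (a : Bool) :
      Point.Link ⟨A, l, a, (!a) :: r, ⟨l, .cap a, r⟩ :: B⟩
        ⟨A, l ++ [a], !a, r, ⟨l, .cap a, r⟩ :: B⟩
  | cup (A B : List Slice) (l r : List Bool) (a : Bool) :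
      Point.Link ⟨A ++ [⟨l, .cup a, r⟩], l, a, (!a) :: r, B⟩
        ⟨A ++ [⟨l, .cup a, r⟩], l ++ [a], !a, r, B⟩
  | crossFirst (A B : List Slice) (l r : List Bool) (o a b : Bool) :
      Point.Link ⟨A, l, a, b :: r, ⟨l, .cross o a b, r⟩ :: B⟩
        ⟨A ++ [⟨l, .cross o a b, r⟩], l ++ [b], a, r, B⟩
  | crossSecond (A B : List Slice) (l r : List Bool) (o a b : Bool) :
      Point.Link ⟨A, l ++ [a], b, r, ⟨l, .cross o a b, r⟩ :: B⟩
        ⟨A ++ [⟨l, .cross o a b, r⟩], l, b, a :: r, B⟩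

/-- A diagram without boundary is a knot diagram if it has exactly one (unicursal) component. -/
def IsKnotDiagram (D : Tangle [] []) : Prop :=
  (∃ p : Point, p.On D.1) ∧
    ∀ p q : Point, p.On D.1 → q.On D.1 → Relation.EqvGen Point.Link p q

/-- Classical oriented knot diagrams in the plane. -/
def KnotDiagram : Type := {D : Tangle [] [] // IsKnotDiagram D}

/-- Knot diagrams up to planar isotopy and Reidemeister moves. -/
def knotSetoid : Setoid KnotDiagram := (tangleSetoid [] []).comap Subtype.val

/-- The set of classical oriented knots. -/
def Knot : Type := Quotient knotSetoid

/-- The knot presented by a diagram. -/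
def KnotDiagram.knot (D : KnotDiagram) : Knot := Quotient.mk knotSetoid D

/-! ## Connected sum -/

/-- The closure of a diagram `d` with one upward end at the bottom and one at the top. -/
def closure (d : List Slice) : List Slice :=
  ⟨[], .cup true, []⟩ :: (pad [] [false] d ++ [⟨[], .cap true, []⟩])

/-- `f` is a diagram of a long knot whose closure is the knot `K`. -/
def Presents (f : Tangle [true] [true]) (K : Knot) : Prop :=
  ∃ D : KnotDiagram, D.1.1 = closure f.1 ∧ D.knot = K

/-- `S` is a connected sum of `K` and `K'`: cut `K` and `K'` open to long knots, and close their
concatenation. -/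
def IsConnectedSum (K K' S : Knot) : Prop :=
  ∃ f g : Tangle [true] [true], Presents f K ∧ Presents g K' ∧
    ∃ D : KnotDiagram, D.1.1 = closure (f.1 ++ g.1) ∧ D.knot = S

/-! ## Skein invariants -/

/-- An oriented `n`-tangle: a diagram in a disk with `2 * n` enumerated endpoints. The disk is a
rectangle whose top side contains all the endpoints. -/
structure NTangle (n : ℕ) : Type where
  boundary : List Bool
  length_boundary : boundary.length = 2 * n
  diagram : Tangle [] boundary

/-- A (monomial) local move: a pair of `n`-tangles with the same oriented boundary. The number `n`
is its degree. -/
structure LocalMove : Type where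
  degree : ℕ
  fst : NTangle degree
  snd : NTangle degree
  boundary_eq : fst.boundary = snd.boundary

/-- The knot `K'` has a diagram that is the result of the application of a move in `M` to a diagram
of `K`. -/
def MoveStep (M : Set LocalMove) (K K' : Knot) : Prop :=
  ∃ m ∈ M, ∃ D D' : KnotDiagram, D.knot = K ∧ D'.knot = K' ∧
    Replace m.fst.diagram.1 m.snd.diagram.1 D.1.1 D'.1.1

/-- Equivalence of knots modulo the set of moves `M`. -/
def skeinSetoid (M : Set LocalMove) : Setoid Knot := Relation.EqvGen.setoid (MoveStep M)

/-- The set of equivalence classes of knots modulo `M`. -/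
def SkeinQuotient (M : Set LocalMove) : Type := Quotient (skeinSetoid M)

/-- The invariant `I` is determined by the set of moves `M`. -/
def IsDeterminedBy {X : Type*} (I : Knot → X) (M : Set LocalMove) : Prop :=
  ∃ f : SkeinQuotient M → X, Function.Injective f ∧
    ∀ K : Knot, I K = f (Quotient.mk (skeinSetoid M) K)

/-- A set of moves is reduced if all its moves have positive degree. -/
def IsReduced (M : Set LocalMove) : Prop := ∀ m ∈ M, 0 < m.degree

/-- `I` is a skein invariant that is determined by a finite reduced set of moves. -/
def IsReducedSkeinInvariant {X : Type*} (I : Knot → X) : Prop :=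
  ∃ M : Set LocalMove, M.Finite ∧ IsReduced M ∧ IsDeterminedBy I M

/-- `I` is additive: its set of values has the structure of a commutative monoid for which `I`
takes connected sums to sums. -/
def IsAdditive {X : Type*} (I : Knot → X) : Prop :=
  ∃ _ : AddCommMonoid X, ∀ K K' S : Knot, IsConnectedSum K K' S → I S = I K + I K'

end SkeinKnot

/-!
Connected sums are studied by inserting a long knot `g` into a diagram at a point (`Point.insert`);
where the strand points downwards, `g` is inserted rotated by a half turn. The closure of a
concatenation `f ++ g` is the closure of `f` with `g` inserted above `f`, and the closure of `g ++
f` is the closure of `f` with `g` inserted below `f`.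

An inserted long knot slides along its component (`Point.Link.insert_iso`). It slides across
crossings because a strand can be swept over or under any tangle (`Iso.sweep_natural`), and across
maxima and minima because the two rotations of `g` differ by a full turn, which the Reidemeister
moves undo (`Iso.rotLeft_rotRight`). Hence, in a knot diagram, the point of insertion does not
matter. Every planar isotopy or Reidemeister move replaces a tangle with nonempty boundary, so `g`
can be inserted at a point on this boundary, outside of the changed part. Therefore the result
depends on the knot only and not on its diagram (`insert_iso`), which gives the uniqueness of
connected sums as well as their commutativity; associativity and the neutral element are inherited
from concatenation. A knot is cut open to a long knot at its lowest slice (`exists_closure_iso`).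

A local move of positive degree has nonempty boundary, too, so it also commutes with the insertion
of `g` at a suitable point (`MoveStep.sum`). Hence the connected sum descends to knots modulo the
moves, that is, to the values of the invariant.

All of this has to stay within knot diagrams. A diagram has exactly one component if and only if it
has exactly two colourings by two colours that are constant on components (`isKnotDiagram_iff`), and
the number of colourings can be computed slice by slice (`run`), which shows that it is invariant
under all moves and controls it for closures of concatenations.
-/

namespace SkeinKnot

/-! ### Stacking and padding of diagrams -/

theorem isTangle_append {a c : List Bool} {d e : List Slice} :
    IsTangle a (d ++ e) c ↔ ∃ b, IsTangle a d b ∧ IsTangle b e c := by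
  induction d generalizing a with
  | nil => simp [IsTangle]
  | cons s d ih => simp [IsTangle, ih, and_assoc]

theorem IsTangle.append {a b c : List Bool} {d e : List Slice} (hd : IsTangle a d b)
    (he : IsTangle b e c) : IsTangle a (d ++ e) c :=
  isTangle_append.2 ⟨b, hd, he⟩

theorem IsTangle.top_unique {a b b' : List Bool} {d : List Slice} (h : IsTangle a d b)
    (h' : IsTangle a d b') : b = b' := by
  induction d generalizing a with
  | nil => exact h.symm.trans h'
  | cons s d ih => exact ih h.2 h'.2

/-- A nonempty diagram determines its bottom word. -/
theorem IsTangle.bottom_unique {a a' b b' : List Bool} {d : List Slice} (hd : d ≠ [])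
    (h : IsTangle a d b) (h' : IsTangle a' d b') : a = a' := by
  cases d with
  | nil => exact absurd rfl hd
  | cons s d => exact h.1.symm.trans h'.1

@[simp] theorem pad_nil (l r : List Bool) : pad l r [] = [] := rfl

@[simp] theorem pad_cons (l r : List Bool) (s : Slice) (d : List Slice) :
    pad l r (s :: d) = ⟨l ++ s.left, s.piece, s.right ++ r⟩ :: pad l r d := rfl

@[simp] theorem pad_append (l r : List Bool) (d e : List Slice) :
    pad l r (d ++ e) = pad l r d ++ pad l r e := by
  simp [pad]

@[simp] theorem pad_pad (l r l' r' : List Bool) (d : List Slice) :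
    pad l r (pad l' r' d) = pad (l ++ l') (r' ++ r) d := by
  simp [pad]

@[simp] theorem pad_empty (d : List Slice) : pad [] [] d = d := by
  simp [pad]

theorem IsTangle.padded {a b : List Bool} {d : List Slice} (l r : List Bool) (h : IsTangle a d b) :
    IsTangle (l ++ a ++ r) (pad l r d) (l ++ b ++ r) := by
  induction d generalizing a with
  | nil => cases h; rfl
  | cons s d ih =>
    obtain ⟨rfl, h⟩ := h
    refine ⟨by simp [Slice.bottom], ?_⟩
    have := ih h
    change IsTangle _ (pad l r d) _
    simpa [Slice.top] using this

theorem isTangle_singleton {a b : List Bool} (s : Slice) (ha : s.bottom = a) (hb : s.top = b) :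
    IsTangle a [s] b :=
  ⟨ha, hb⟩

/-! ### Equivalence of diagrams -/

/-- Two lists of slices are diagrams of the same tangle with bottom word `a` and top word `b`:
both are diagrams with this boundary, and planar isotopies and Reidemeister moves connect them. -/
def Iso (a b : List Bool) (d d' : List Slice) : Prop :=
  ∃ (h : IsTangle a d b) (h' : IsTangle a d' b),
    Relation.EqvGen Step (⟨d, h⟩ : Tangle a b) ⟨d', h'⟩

namespace Iso

variable {a b c : List Bool} {d d' d'' e e' : List Slice}

theorem left (h : Iso a b d d') : IsTangle a d b := h.1

theorem right (h : Iso a b d d') : IsTangle a d' b := h.2.1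

theorem refl (h : IsTangle a d b) : Iso a b d d := ⟨h, h, .refl _⟩

theorem symm (h : Iso a b d d') : Iso a b d' d := ⟨h.2.1, h.1, .symm _ _ h.2.2⟩

theorem trans (h : Iso a b d d') (h' : Iso a b d' d'') : Iso a b d d'' :=
  ⟨h.1, h'.2.1, .trans _ _ _ h.2.2 h'.2.2⟩

instance : Trans (Iso a b) (Iso a b) (Iso a b) := ⟨trans⟩

/-- An operation on diagrams that preserves boundaries and elementary moves preserves
equivalence. -/
theorem lift {a' b' : List Bool} (F : List Slice → List Slice)
    (hF : ∀ d, IsTangle a d b → IsTangle a' (F d) b')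
    (hR : ∀ t t' d d', Replace t t' d d' → Replace t t' (F d) (F d'))
    (h : Iso a b d d') : Iso a' b' (F d) (F d') := by
  obtain ⟨h₁, h₂, h⟩ := h
  refine ⟨hF _ h₁, hF _ h₂, ?_⟩
  have key : ∀ D D' : Tangle a b, Relation.EqvGen Step D D' →
      Relation.EqvGen Step (⟨F D.1, hF _ D.2⟩ : Tangle a' b') ⟨F D'.1, hF _ D'.2⟩ := by
    intro D D' hD
    induction hD with
    | rel x y hxy =>
      obtain ⟨t, t', hm, hr⟩ := hxy
      exact .rel _ _ ⟨t, t', hm, hR _ _ _ _ hr⟩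
    | refl x => exact .refl _
    | symm x y _ ih => exact .symm _ _ ih
    | trans x y z _ _ ih₁ ih₂ => exact .trans _ _ _ ih₁ ih₂
  exact key _ _ h

theorem append_left (he : IsTangle a e b) (h : Iso b c d d') : Iso a c (e ++ d) (e ++ d') := by
  refine lift (fun d => e ++ d) (fun d hd => he.append hd) ?_ h
  rintro t t' d d' ⟨A, B, l, r, rfl, rfl⟩
  exact ⟨e ++ A, B, l, r, by simp, by simp⟩

theorem append_right (h : Iso a b d d') (he : IsTangle b e c) : Iso a c (d ++ e) (d' ++ e) := by
  refine lift (fun d => d ++ e) (fun d hd => hd.append he) ?_ h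
  rintro t t' d d' ⟨A, B, l, r, rfl, rfl⟩
  exact ⟨A, B ++ e, l, r, by simp, by simp⟩

theorem append (h : Iso a b d d') (h' : Iso b c e e') : Iso a c (d ++ e) (d' ++ e') :=
  (append_right h h'.left).trans (append_left h.right h')

theorem padded (l r : List Bool) (h : Iso a b d d') :
    Iso (l ++ a ++ r) (l ++ b ++ r) (pad l r d) (pad l r d') := by
  refine lift (pad l r) (fun d hd => hd.padded l r) ?_ h
  rintro t t' d d' ⟨A, B, l', r', rfl, rfl⟩
  exact ⟨pad l r A, pad l r B, l ++ l', r' ++ r, by simp, by simp⟩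

/-- Equivalent parts of a diagram can be replaced by each other. -/
theorem within {x y : List Bool} {A B : List Slice} (h : Iso a b d d') (l r : List Bool)
    (hA : IsTangle x A (l ++ a ++ r)) (hB : IsTangle (l ++ b ++ r) B y) :
    Iso x y (A ++ (pad l r d ++ B)) (A ++ (pad l r d' ++ B)) :=
  ((h.padded l r).append_right hB).append_left hA

theorem planar (h : PlanarMove d d') (hd : IsTangle a d b) (hd' : IsTangle a d' b) :
    Iso a b d d' :=
  ⟨hd, hd', .rel _ _ ⟨d, d', .inl h, [], [], [], [], by simp, by simp⟩⟩

theorem reidemeister (h : ReidemeisterMove d d') (hd : IsTangle a d b) (hd' : IsTangle a d' b) :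
    Iso a b d d' :=
  ⟨hd, hd', .rel _ _ ⟨d, d', .inr h, [], [], [], [], by simp, by simp⟩⟩

end Iso

/-! ### Distant diagrams exchange their heights -/

theorem Iso.exchange_slice (l r l' r' m : List Bool) (g h : Piece) :
    Iso (l ++ g.bottom ++ r ++ m ++ l' ++ h.bottom ++ r') (l ++ g.top ++ r ++ m ++ l' ++ h.top ++ r')
      [⟨l, g, r ++ m ++ l' ++ h.bottom ++ r'⟩, ⟨l ++ g.top ++ r ++ m ++ l', h, r'⟩]
      [⟨l ++ g.bottom ++ r ++ m ++ l', h, r'⟩, ⟨l, g, r ++ m ++ l' ++ h.top ++ r'⟩] := by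
  have := Iso.padded l r' (Iso.planar (.exchange g h (r ++ m ++ l'))
    (a := g.bottom ++ (r ++ m ++ l') ++ h.bottom) (b := g.top ++ (r ++ m ++ l') ++ h.top)
    (by simp [IsTangle, Slice.bottom, Slice.top]) (by simp [IsTangle, Slice.bottom, Slice.top]))
  simpa using this

/-- Two diagrams that stand side by side exchange their heights. -/
theorem Iso.exchange {a b c d : List Bool} {t s : List Slice} (m : List Bool)
    (ht : IsTangle a t b) (hs : IsTangle c s d) :
    Iso (a ++ m ++ c) (b ++ m ++ d) (pad [] (m ++ c) t ++ pad (b ++ m) [] s)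
      (pad (a ++ m) [] s ++ pad [] (m ++ d) t) := by
  have one : ∀ (x : Slice) (c : List Bool) (s : List Slice), IsTangle c s d →
      Iso (x.bottom ++ m ++ c) (x.top ++ m ++ d) (pad [] (m ++ c) [x] ++ pad (x.top ++ m) [] s)
        (pad (x.bottom ++ m) [] s ++ pad [] (m ++ d) [x]) := by
    intro x c s
    induction s generalizing c with
    | nil =>
      rintro rfl
      exact Iso.refl (by simp [IsTangle, Slice.bottom, Slice.top])
    | cons y s ih =>
      rintro ⟨rfl, hs⟩
      have h₁ := Iso.exchange_slice x.left x.right y.left y.right m x.piece y.piece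
      have h₂ := ih _ hs
      have h₃ := h₁.append_right (c := x.top ++ m ++ d) (e := pad (x.top ++ m) [] s) (by
        have := hs.padded (x.top ++ m) []
        simpa [Slice.top] using this)
      have h₄ := h₂.append_left (a := x.bottom ++ m ++ y.bottom)
        (e := [⟨x.left ++ x.piece.bottom ++ x.right ++ m ++ y.left, y.piece, y.right⟩])
        (by simp [IsTangle, Slice.top, Slice.bottom])
      simp only [Slice.top, Slice.bottom, pad_cons, pad_nil, List.append_assoc, List.cons_append,
        List.nil_append, List.append_nil] at h₃ h₄ ⊢
      exact h₃.trans h₄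
  induction t generalizing a with
  | nil =>
    cases ht
    have := hs.padded (b ++ m) []
    simpa using Iso.refl this
  | cons x t ih =>
    obtain ⟨rfl, ht⟩ := ht
    have h₁ := (ih ht).append_left (a := x.bottom ++ m ++ c) (e := pad [] (m ++ c) [x])
      (by simp [IsTangle, Slice.top, Slice.bottom])
    have h₂ := (one x c s hs).append_right (c := b ++ m ++ d) (e := pad [] (m ++ d) t) (by
        have := ht.padded [] (m ++ d)
        simpa [Slice.top] using this)
    have := h₁.trans (by simpa using h₂)
    simpa using this

/-! ### A strand passes over or under a diagram -/

/-- The strand of direction `b` to the right of the strands `w` moves to their left. It is the lower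
strand at all crossings if `o = true`, and the upper strand at all crossings otherwise. -/
def sweep (o : Bool) : List Bool → Bool → List Slice
  | [], _ => []
  | x :: w, b => pad [x] [] (sweep o w b) ++ [⟨[], .cross o x b, w⟩]

theorem isTangle_sweep (o : Bool) (w : List Bool) (b : Bool) :
    IsTangle (w ++ [b]) (sweep o w b) (b :: w) := by
  induction w with
  | nil => rfl
  | cons x w ih =>
    have := ih.padded [x] []
    exact IsTangle.append (by simpa using this)
      (isTangle_singleton _ (by simp [Slice.bottom, Piece.bottom]) (by simp [Slice.top, Piece.top]))

theorem sweep_append (o : Bool) (u v : List Bool) (b : Bool) :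
    sweep o (u ++ v) b = pad u [] (sweep o v b) ++ pad [] v (sweep o u b) := by
  induction u with
  | nil => simp [sweep]
  | cons x u ih => simp [sweep, ih]

theorem Iso.two (o a b : Bool) :
    Iso [a, b] [a, b] [⟨[], .cross o a b, []⟩, ⟨[], .cross (!o) b a, []⟩] [] :=
  .reidemeister (.two o a b) ⟨rfl, rfl, rfl⟩ rfl

theorem Iso.capCross (o a b : Bool) :
    Iso [a, b, !a] [b] [⟨[a], .cross o b (!a), []⟩, ⟨[], .cap a, [b]⟩]
      [⟨[], .cross (!o) a b, [!a]⟩, ⟨[b], .cap a, []⟩] :=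
  .planar (.capCross o a b) ⟨rfl, rfl, rfl⟩ ⟨rfl, rfl, rfl⟩

theorem Iso.cupCross (o a b : Bool) :
    Iso [b] [a, b, !a] [⟨[], .cup a, [b]⟩, ⟨[a], .cross o (!a) b, []⟩]
      [⟨[b], .cup a, []⟩, ⟨[], .cross (!o) b a, [!a]⟩] :=
  .planar (.cupCross o a b) ⟨rfl, rfl, rfl⟩ ⟨rfl, rfl, rfl⟩

theorem Iso.zigzag (a : Bool) :
    Iso [a] [a] [⟨[a], .cup (!a), []⟩, ⟨[], .cap a, [a]⟩] [] :=
  .planar (.zigzag a) (by cases a <;> exact ⟨rfl, rfl, rfl⟩) rfl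

theorem Iso.zagzig (a : Bool) :
    Iso [a] [a] [⟨[], .cup a, [a]⟩, ⟨[a], .cap (!a), []⟩] [] :=
  .planar (.zagzig a) (by cases a <;> exact ⟨rfl, rfl, rfl⟩) rfl

theorem Iso.three (o p q a b c : Bool) (h : o = q → p = o) :
    Iso [a, b, c] [c, b, a]
      [⟨[], .cross o a b, [c]⟩, ⟨[b], .cross p a c, []⟩, ⟨[], .cross q b c, [a]⟩]
      [⟨[a], .cross q b c, []⟩, ⟨[], .cross p a c, [b]⟩, ⟨[c], .cross o a b, []⟩] :=
  .reidemeister (.three o p q a b c h) ⟨rfl, rfl, rfl, rfl⟩ ⟨rfl, rfl, rfl, rfl⟩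

theorem Iso.sweep_piece (o b : Bool) (g : Piece) :
    Iso (g.bottom ++ [b]) (b :: g.top) ([⟨[], g, [b]⟩] ++ sweep o g.top b)
      (sweep o g.bottom b ++ [⟨[b], g, []⟩]) := by
  cases g with
  | cap a =>
    have h₁ := (Iso.two o (!a) b).padded [a] []
    have h₂ := (Iso.capCross (!o) a b)
    have h₃ := h₁.append_right (e := [⟨[], .cap a, [b]⟩]) (c := [b]) ⟨rfl, rfl⟩
    have h₄ := h₂.append_left (e := [⟨[a], .cross o (!a) b, []⟩]) (a := [a, !a, b]) ⟨rfl, rfl⟩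
    rw [Bool.not_not] at h₄
    exact h₃.symm.trans h₄
  | cup a =>
    have h₁ := (Iso.two (!o) b a).padded [] [!a]
    have h₂ := (Iso.cupCross o a b)
    have h₃ := h₂.append_right (e := [⟨[], .cross o a b, [!a]⟩]) (c := [b, a, !a]) ⟨rfl, rfl⟩
    have h₄ := h₁.append_left (e := [⟨[b], .cup a, []⟩]) (a := [b]) ⟨rfl, rfl⟩
    rw [Bool.not_not] at h₄
    exact h₃.trans h₄
  | cross p x y => exact Iso.three p o o x y b (fun h => h.symm)

theorem Iso.sweep_slice (o b : Bool) (s : Slice) :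
    Iso (s.bottom ++ [b]) (b :: s.top) (pad [] [b] [s] ++ sweep o s.top b)
      (sweep o s.bottom b ++ pad [b] [] [s]) := by
  obtain ⟨l, g, r⟩ := s
  have hg : IsTangle g.bottom [⟨[], g, []⟩] g.top :=
    isTangle_singleton _ (by simp [Slice.bottom]) (by simp [Slice.top])
  have h₁ := (Iso.exchange [] hg (isTangle_sweep o r b)).padded l []
  have h₂ := (Iso.sweep_piece o b g).padded l r
  have h₃ := (Iso.exchange [] (isTangle_sweep o l b) hg).symm.padded [] r
  have k₁ := h₁.append_right (c := b :: (l ++ g.top ++ r))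
    (e := pad l r (sweep o g.top b) ++ pad [] (g.top ++ r) (sweep o l b)) (by
      have u := (isTangle_sweep o g.top b).padded l r
      have v := (isTangle_sweep o l b).padded [] (g.top ++ r)
      refine IsTangle.append (by simpa using u) (by simpa using v))
  have k₂ := (h₂.append_right (c := b :: (l ++ g.top ++ r))
    (e := pad [] (g.top ++ r) (sweep o l b)) (by
      have v := (isTangle_sweep o l b).padded [] (g.top ++ r)
      simpa using v)).append_left (a := l ++ g.bottom ++ r ++ [b])
      (e := pad (l ++ g.bottom) [] (sweep o r b)) (by
      have v := (isTangle_sweep o r b).padded (l ++ g.bottom) []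
      simpa using v)
  have k₃ := h₃.append_left (a := l ++ g.bottom ++ r ++ [b])
      (e := pad (l ++ g.bottom) [] (sweep o r b) ++ pad l r (sweep o g.bottom b)) (by
      have v := (isTangle_sweep o r b).padded (l ++ g.bottom) []
      have u := (isTangle_sweep o g.bottom b).padded l r
      refine IsTangle.append (by simpa using v) (by simpa using u))
  simp only [Slice.top, Slice.bottom, sweep_append, pad_append, pad_pad, pad_cons, pad_nil,
    List.append_assoc, List.cons_append, List.nil_append, List.append_nil] at k₁ k₂ k₃ ⊢
  exact k₁.trans (k₂.trans k₃)

/-- A strand can be moved from a level above a diagram to a level below it. -/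
theorem Iso.sweep_natural (o b : Bool) {x y : List Bool} {t : List Slice} (ht : IsTangle x t y) :
    Iso (x ++ [b]) (b :: y) (pad [] [b] t ++ sweep o y b) (sweep o x b ++ pad [b] [] t) := by
  induction t generalizing x with
  | nil =>
    cases ht
    simpa using Iso.refl (isTangle_sweep o y b)
  | cons s t ih =>
    obtain ⟨rfl, ht⟩ := ht
    have h₁ := (ih ht).append_left (a := s.bottom ++ [b]) (e := pad [] [b] [s])
      (by simp [IsTangle, Slice.bottom, Slice.top])
    have h₂ := (Iso.sweep_slice o b s).append_right (c := b :: y) (e := pad [b] [] t) (by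
      have := ht.padded [b] []
      simpa using this)
    simp only [pad_cons, pad_nil, List.append_assoc, List.cons_append, List.nil_append] at h₁ h₂ ⊢
    exact h₁.trans h₂

/-- A diagram on one strand slides along the first strand of a crossing. -/
theorem Iso.slide_cross_first (o a b : Bool) {t : List Slice} (ht : IsTangle [a] t [a]) :
    Iso [a, b] [b, a] (pad [] [b] t ++ [⟨[], .cross o a b, []⟩])
      ([⟨[], .cross o a b, []⟩] ++ pad [b] [] t) :=
  Iso.sweep_natural o b ht

/-- A diagram on one strand slides along the second strand of a crossing. -/
theorem Iso.slide_cross_second (o a b : Bool) {t : List Slice} (ht : IsTangle [b] t [b]) :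
    Iso [a, b] [b, a] (pad [a] [] t ++ [⟨[], .cross o a b, []⟩])
      ([⟨[], .cross o a b, []⟩] ++ pad [] [a] t) := by
  have h := Iso.slide_cross_first (!o) b a ht
  have hl : IsTangle [a, b] (pad [a] [] t) [a, b] := ht.padded [a] []
  have hr : IsTangle [b, a] (pad [] [a] t) [b, a] := ht.padded [] [a]
  have hx : IsTangle [a, b] [⟨[], .cross o a b, []⟩] [b, a] := ⟨rfl, rfl⟩
  -- Conjugate by the crossing the slide over the inverse crossing.
  have h₁ := (h.append_left hx).append_right hx
  have h₂ := (Iso.two o a b).append_right (hl.append hx)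
  have h₃ := (Iso.two (!o) b a).append_left (hx.append hr)
  simp only [Bool.not_not, List.append_assoc, List.cons_append, List.nil_append,
    List.append_nil] at h₁ h₂ h₃ ⊢
  exact h₂.symm.trans (h₁.symm.trans h₃)

/-! ### Rotation of a diagram on one strand -/

theorem Iso.oneRight (o a : Bool) :
    Iso [a] [a] [⟨[a], .cup a, []⟩, ⟨[], .cross o a a, [!a]⟩, ⟨[a], .cap a, []⟩] [] :=
  .reidemeister (.oneRight o a) ⟨rfl, rfl, rfl, rfl⟩ rfl

/-- A minimum followed by a crossing of its legs is a minimum of the opposite direction. -/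
theorem Iso.cup_cross (o a : Bool) :
    Iso [] [!a, a] [⟨[], .cup a, []⟩, ⟨[], .cross o a (!a), []⟩] [⟨[], .cup (!a), []⟩] := by
  -- Create a curl on the right leg. The minimum that belongs to the curl is moved down, its crossing
  -- is moved to the other leg of the given minimum, and this minimum cancels with the maximum.
  have h₁ := (Iso.oneRight (!o) a).within [!a] [] (A := [⟨[], .cup (!a), []⟩]) (B := [])
    (x := []) (y := [!a, a]) (by cases a <;> exact ⟨rfl, rfl⟩) rfl
  have h₂ := (Iso.exchange_slice [] [] [] [] [] (.cup (!a)) (.cup a)).append_right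
    (e := [⟨[!a], .cross (!o) a a, [!a]⟩, ⟨[!a, a], .cap a, []⟩]) (c := [!a, a])
    (by cases a <;> exact ⟨rfl, rfl, rfl⟩)
  have h₃ := (Iso.cupCross (!o) (!a) a).within [] [!a] (A := [⟨[], .cup a, []⟩])
    (B := [⟨[!a, a], .cap a, []⟩]) (x := []) (y := [!a, a])
    (by cases a <;> exact ⟨rfl, rfl⟩) (by cases a <;> exact ⟨rfl, rfl⟩)
  have h₄ := (Iso.exchange_slice [] [] [] [] [] (.cross o a (!a)) (.cap a)).append_left
    (e := [⟨[], .cup a, []⟩, ⟨[a], .cup (!a), [!a]⟩]) (a := [])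
    (by cases a <;> exact ⟨rfl, rfl, rfl⟩)
  have h₅ := (Iso.zagzig (!a)).within [a] [] (A := [⟨[], .cup a, []⟩])
    (B := [⟨[], .cross o a (!a), []⟩]) (x := []) (y := [!a, a])
    (by cases a <;> exact ⟨rfl, rfl⟩) (by cases a <;> exact ⟨rfl, rfl⟩)
  simp only [pad_cons, pad_nil, Piece.bottom, Piece.top, Bool.not_not, List.cons_append,
    List.nil_append, List.append_nil] at h₁ h₂ h₃ h₄ h₅
  exact h₅.symm.trans (h₄.symm.trans (h₃.symm.trans (h₂.symm.trans h₁)))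

/-- A maximum after a crossing of its legs is a maximum of the opposite direction. -/
theorem Iso.cross_cap (o a : Bool) :
    Iso [!a, a] [] [⟨[], .cross o (!a) a, []⟩, ⟨[], .cap a, []⟩] [⟨[], .cap (!a), []⟩] := by
  -- The construction of `Iso.cup_cross`, upside down.
  have h₁ := (Iso.oneRight (!o) a).within [!a] [] (B := [⟨[], .cap (!a), []⟩]) (A := [])
    (y := []) (x := [!a, a]) rfl (by cases a <;> exact ⟨rfl, rfl⟩)
  have h₂ := (Iso.exchange_slice [] [] [] [] [] (.cap (!a)) (.cap a)).append_left
    (e := [⟨[!a, a], .cup a, []⟩, ⟨[!a], .cross (!o) a a, [!a]⟩]) (a := [!a, a])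
    (by cases a <;> exact ⟨rfl, rfl, rfl⟩)
  have h₃ := (Iso.capCross (!o) (!a) a).within [] [!a] (A := [⟨[!a, a], .cup a, []⟩])
    (B := [⟨[], .cap a, []⟩]) (y := []) (x := [!a, a])
    (by cases a <;> exact ⟨rfl, rfl⟩) (by cases a <;> exact ⟨rfl, rfl⟩)
  have h₄ := (Iso.exchange_slice [] [] [] [] [] (.cross o (!a) a) (.cup a)).append_right
    (e := [⟨[a], .cap (!a), [!a]⟩, ⟨[], .cap a, []⟩]) (c := [])
    (by cases a <;> exact ⟨rfl, rfl, rfl⟩)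
  have h₅ := (Iso.zigzag (!a)).within [a] [] (B := [⟨[], .cap a, []⟩])
    (A := [⟨[], .cross o (!a) a, []⟩]) (y := []) (x := [!a, a])
    (by cases a <;> exact ⟨rfl, rfl⟩) (by cases a <;> exact ⟨rfl, rfl⟩)
  simp only [pad_cons, pad_nil, Piece.bottom, Piece.top, Bool.not_not, List.cons_append,
    List.nil_append, List.append_nil] at h₁ h₂ h₃ h₄ h₅
  exact h₅.symm.trans (h₄.trans (h₃.symm.trans (h₂.trans h₁)))

/-- The diagram `g` on one upward strand, rotated by a half turn: the strand enters from above on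
the right of `g` and leaves downwards on its left. -/
def rotLeft (g : List Slice) : List Slice :=
  [⟨[false], .cup true, []⟩] ++ (pad [false] [false] g ++ [⟨[], .cap false, [false]⟩])

/-- The diagram `g` on one upward strand, rotated by a half turn in the other direction: the strand
enters from above on the left of `g` and leaves downwards on its right. -/
def rotRight (g : List Slice) : List Slice :=
  [⟨[], .cup false, [false]⟩] ++ (pad [false] [false] g ++ [⟨[false], .cap true, []⟩])

section

variable {g : List Slice}

theorem isTangle_rotRight (hg : IsTangle [true] g [true]) :
    IsTangle [false] (rotRight g) [false] :=
  IsTangle.append (b := [false, true, false]) (by exact ⟨rfl, rfl⟩)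
    ((hg.padded [false] [false]).append (by exact ⟨rfl, rfl⟩))

/-- The two rotations differ by a full turn, which Reidemeister moves undo: a strand is swept
across `g`, after which all crossings cancel. -/
theorem Iso.rotLeft_rotRight (hg : IsTangle [true] g [true]) :
    Iso [false] [false] (rotLeft g) (rotRight g) := by
  -- Reverse the minimum and the maximum at the cost of two crossings, and move `g` below both.
  have h₁ := (Iso.cup_cross true false).within [false] []
    (A := []) (B := pad [false] [false] g ++ [⟨[], .cap false, [false]⟩])
    (x := [false]) (y := [false]) rfl ((hg.padded [false] [false]).append (by exact ⟨rfl, rfl⟩))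
  have h₂ := (Iso.cross_cap false true).within [] [false]
    (A := [⟨[false], .cup false, []⟩, ⟨[false], .cross true false true, []⟩] ++
      pad [false] [false] g) (B := []) (x := [false]) (y := [false])
    (IsTangle.append (b := [false, true, false]) (by exact ⟨rfl, rfl, rfl⟩)
      (hg.padded [false] [false])) rfl
  have h₃ := (Iso.slide_cross_second true false true hg).within [false] []
    (A := [⟨[false], .cup false, []⟩])
    (B := [⟨[], .cross false false true, [false]⟩, ⟨[], .cap true, [false]⟩])
    (x := [false]) (y := [false]) (by exact ⟨rfl, rfl⟩) ⟨rfl, rfl, rfl⟩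
  -- The strand on the left is swept across the minimum with `g` on its right leg.
  have hu : IsTangle [] ([⟨[], .cup false, []⟩] ++ pad [false] [] g) [false, true] :=
    IsTangle.append (b := [false, true]) (by exact ⟨rfl, rfl⟩) (hg.padded [false] [])
  have h₄ := (Iso.sweep_natural true false hu).append_right (c := [false])
    (e := [⟨[false], .cross true false true, []⟩, ⟨[], .cross false false true, [false]⟩,
      ⟨[], .cap true, [false]⟩]) ⟨rfl, rfl, rfl, rfl⟩
  -- After a third Reidemeister move all crossings cancel, and the maximum of the right rotation
  -- remains.
  have k₁ := (Iso.three true true true false true false (fun _ => rfl)).append_right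
    (e := [⟨[], .cross false false true, [false]⟩, ⟨[], .cap true, [false]⟩]) (c := [false])
    ⟨rfl, rfl, rfl⟩
  have k₂ := (Iso.two true true false).within [] [false]
    (A := [⟨[], .cross true false true, [false]⟩, ⟨[true], .cross true false false, []⟩])
    (B := [⟨[], .cap true, [false]⟩]) (x := [false, true, false]) (y := [false])
    ⟨rfl, rfl, rfl⟩ (by exact ⟨rfl, rfl⟩)
  have k₃ := (Iso.capCross true true false).append_left
    (e := [⟨[], .cross true false true, [false]⟩]) (a := [false, true, false]) (by exact ⟨rfl, rfl⟩)
  have k₄ := (Iso.two true false true).within [] [false] (A := [])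
    (B := [⟨[false], .cap true, []⟩]) (x := [false, true, false]) (y := [false]) rfl
    (by exact ⟨rfl, rfl⟩)
  have k := (k₁.symm.trans (k₂.trans (k₃.trans k₄))).append_left (a := [false])
    (e := [⟨[], .cup false, [false]⟩] ++ pad [false] [false] g)
    (IsTangle.append (b := [false, true, false]) (by exact ⟨rfl, rfl⟩) (hg.padded [false] [false]))
  simp only [sweep, rotLeft, rotRight, pad_cons, pad_nil, pad_append, pad_pad, Bool.not_true,
    Bool.not_false, List.append_assoc, List.cons_append, List.nil_append, List.append_nil]
    at h₁ h₂ h₃ h₄ k ⊢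
  exact h₁.symm.trans (h₂.symm.trans (h₃.symm.trans (h₄.symm.trans k)))

/-- The diagram `g` on one upward strand, as a diagram on a strand of the given direction. -/
def orient (g : List Slice) : Bool → List Slice
  | true => g
  | false => rotRight g

theorem isTangle_orient (hg : IsTangle [true] g [true]) (a : Bool) :
    IsTangle [a] (orient g a) [a] := by
  cases a
  · exact isTangle_rotRight hg
  · exact hg

theorem Iso.slide_cap_rotRight (hg : IsTangle [true] g [true]) :
    Iso [true, false] [] (pad [true] [] (rotRight g) ++ [⟨[], .cap true, []⟩])
      (pad [] [false] g ++ [⟨[], .cap true, []⟩]) := by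
  have h₁ := (Iso.exchange_slice [] [] [] [] [] (.cap true) (.cap true)).append_left
    (e := [⟨[true], .cup false, [false]⟩] ++ pad [true, false] [false] g) (a := [true, false])
    (IsTangle.append (b := [true, false, true, false]) (by exact ⟨rfl, rfl⟩)
      (hg.padded [true, false] [false]))
  have h₂ := (Iso.exchange [] (t := [⟨[], .cap true, []⟩]) (a := [true, false]) (b := [])
    (by exact ⟨rfl, rfl⟩) hg).within [] [false] (A := [⟨[true], .cup false, [false]⟩])
    (B := [⟨[], .cap true, []⟩]) (x := [true, false]) (y := []) (by exact ⟨rfl, rfl⟩)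
    (by exact ⟨rfl, rfl⟩)
  have h₃ := (Iso.zigzag true).within [] [false] (A := [])
    (B := pad [] [false] g ++ [⟨[], .cap true, []⟩]) (x := [true, false]) (y := []) rfl
    ((hg.padded [] [false]).append (by exact ⟨rfl, rfl⟩))
  simp only [rotRight, Piece.bottom, Piece.top, pad_cons, pad_nil, pad_append, pad_pad,
    Bool.not_true, List.append_assoc, List.cons_append, List.nil_append,
    List.append_nil] at h₁ h₂ h₃ ⊢
  exact h₁.symm.trans (h₂.symm.trans h₃)

theorem Iso.slide_cap_rotLeft (hg : IsTangle [true] g [true]) :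
    Iso [false, true] [] (pad [] [true] (rotLeft g) ++ [⟨[], .cap false, []⟩])
      (pad [false] [] g ++ [⟨[], .cap false, []⟩]) := by
  have h₁ := (Iso.exchange_slice [] [] [] [] [] (.cap false) (.cap false)).append_left
    (e := [⟨[false], .cup true, [true]⟩] ++ pad [false] [false, true] g) (a := [false, true])
    (IsTangle.append (b := [false, true, false, true]) (by exact ⟨rfl, rfl⟩)
      (hg.padded [false] [false, true]))
  have h₂ := (Iso.exchange [] (s := [⟨[], .cap false, []⟩]) (c := [false, true]) (d := [])
    hg (by exact ⟨rfl, rfl⟩)).within [false] [] (A := [⟨[false], .cup true, [true]⟩])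
    (B := [⟨[], .cap false, []⟩]) (x := [false, true]) (y := []) (by exact ⟨rfl, rfl⟩)
    (by exact ⟨rfl, rfl⟩)
  have h₃ := (Iso.zagzig true).within [false] [] (A := [])
    (B := pad [false] [] g ++ [⟨[], .cap false, []⟩]) (x := [false, true]) (y := []) rfl
    ((hg.padded [false] []).append (by exact ⟨rfl, rfl⟩))
  simp only [rotLeft, Piece.bottom, Piece.top, pad_cons, pad_nil, pad_append, pad_pad,
    Bool.not_true, Bool.not_false, List.append_assoc, List.cons_append, List.nil_append,
    List.append_nil] at h₁ h₂ h₃ ⊢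
  exact h₁.trans (h₂.trans h₃)

theorem Iso.slide_cup_rotLeft (hg : IsTangle [true] g [true]) :
    Iso [] [true, false] ([⟨[], .cup true, []⟩] ++ pad [true] [] (rotLeft g))
      ([⟨[], .cup true, []⟩] ++ pad [] [false] g) := by
  have h₁ := (Iso.exchange_slice [] [] [] [] [] (.cup true) (.cup true)).append_right
    (e := pad [true, false] [false] g ++ [⟨[true], .cap false, [false]⟩]) (c := [true, false])
    (IsTangle.append (b := [true, false, true, false]) (hg.padded [true, false] [false])
      (by exact ⟨rfl, rfl⟩))
  have h₂ := (Iso.exchange [] (t := [⟨[], .cup true, []⟩]) (a := []) (b := [true, false])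
    (by exact ⟨rfl, rfl⟩) hg).within [] [false] (A := [⟨[], .cup true, []⟩])
    (B := [⟨[true], .cap false, [false]⟩]) (x := []) (y := [true, false]) (by exact ⟨rfl, rfl⟩)
    (by exact ⟨rfl, rfl⟩)
  have h₃ := (Iso.zagzig true).within [] [false] (A := [⟨[], .cup true, []⟩] ++ pad [] [false] g)
    (B := []) (x := []) (y := [true, false])
    (IsTangle.append (b := [true, false]) (by exact ⟨rfl, rfl⟩) (hg.padded [] [false])) rfl
  simp only [rotLeft, Piece.bottom, Piece.top, pad_cons, pad_nil, pad_append, pad_pad,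
    Bool.not_true, List.append_assoc, List.cons_append, List.nil_append,
    List.append_nil] at h₁ h₂ h₃ ⊢
  exact h₁.trans (h₂.trans h₃)

theorem Iso.slide_cup_rotRight (hg : IsTangle [true] g [true]) :
    Iso [] [false, true] ([⟨[], .cup false, []⟩] ++ pad [] [true] (rotRight g))
      ([⟨[], .cup false, []⟩] ++ pad [false] [] g) := by
  have h₁ := (Iso.exchange_slice [] [] [] [] [] (.cup false) (.cup false)).append_right
    (e := pad [false] [false, true] g ++ [⟨[false], .cap true, [true]⟩]) (c := [false, true])
    (IsTangle.append (b := [false, true, false, true]) (hg.padded [false] [false, true])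
      (by exact ⟨rfl, rfl⟩))
  have h₂ := (Iso.exchange [] (s := [⟨[], .cup false, []⟩]) (c := []) (d := [false, true])
    hg (by exact ⟨rfl, rfl⟩)).within [false] [] (A := [⟨[], .cup false, []⟩])
    (B := [⟨[false], .cap true, [true]⟩]) (x := []) (y := [false, true]) (by exact ⟨rfl, rfl⟩)
    (by exact ⟨rfl, rfl⟩)
  have h₃ := (Iso.zigzag true).within [false] [] (A := [⟨[], .cup false, []⟩] ++ pad [false] [] g)
    (B := []) (x := []) (y := [false, true])
    (IsTangle.append (b := [false, true]) (by exact ⟨rfl, rfl⟩) (hg.padded [false] [])) rfl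
  simp only [rotRight, Piece.bottom, Piece.top, pad_cons, pad_nil, pad_append, pad_pad,
    Bool.not_true, Bool.not_false, List.append_assoc, List.cons_append, List.nil_append,
    List.append_nil] at h₁ h₂ h₃ ⊢
  exact h₁.symm.trans (h₂.symm.trans h₃)

/-- A diagram on one strand slides across a maximum. -/
theorem Iso.slide_cap (hg : IsTangle [true] g [true]) (a : Bool) :
    Iso [a, !a] [] (pad [] [!a] (orient g a) ++ [⟨[], .cap a, []⟩])
      (pad [a] [] (orient g (!a)) ++ [⟨[], .cap a, []⟩]) := by
  cases a
  · exact (((Iso.rotLeft_rotRight hg).symm.padded [] [true]).append_right (by exact ⟨rfl, rfl⟩)).trans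
      (Iso.slide_cap_rotLeft hg)
  · exact (Iso.slide_cap_rotRight hg).symm

/-- A diagram on one strand slides across a minimum. -/
theorem Iso.slide_cup (hg : IsTangle [true] g [true]) (a : Bool) :
    Iso [] [a, !a] ([⟨[], .cup a, []⟩] ++ pad [] [!a] (orient g a))
      ([⟨[], .cup a, []⟩] ++ pad [a] [] (orient g (!a))) := by
  cases a
  · exact Iso.slide_cup_rotRight hg
  · exact (Iso.slide_cup_rotLeft hg).symm.trans
      (((Iso.rotLeft_rotRight hg).padded [true] []).append_left (by exact ⟨rfl, rfl⟩))

end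

/-! ### Insertion of a long knot at a point of a diagram -/

/-- The diagram in which a small copy of the diagram `g` on one upward strand is inserted at the
point `p`. -/
def Point.insert (g : List Slice) (p : Point) : List Slice :=
  p.before ++ (pad p.left p.right (orient g p.dir) ++ p.after)

theorem Point.Link.before_append_after {p q : Point} (h : Point.Link p q) :
    p.before ++ p.after = q.before ++ q.after := by
  cases h <;> simp

theorem Piece.isTangle (g : Piece) : IsTangle g.bottom [⟨[], g, []⟩] g.top :=
  isTangle_singleton _ (by simp [Slice.bottom]) (by simp [Slice.top])

theorem isTangle_split {a b : List Bool} {A B : List Slice} {s : Slice}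
    (h : IsTangle a (A ++ s :: B) b) : IsTangle a A s.bottom ∧ IsTangle s.top B b := by
  obtain ⟨w, hA, rfl, hB⟩ := isTangle_append.1 h
  exact ⟨hA, hB⟩

/-- Inserted long knots slide along the arcs of a diagram. -/
theorem Point.Link.insert_iso {g : List Slice} (hg : IsTangle [true] g [true]) {p q : Point}
    (h : Point.Link p q) (hD : IsTangle [] (p.before ++ p.after) []) :
    Iso [] [] (p.insert g) (q.insert g) := by
  have ho := isTangle_orient hg
  cases h with
  | strandLeft A B l₁ l₂ r a x =>
    obtain ⟨hA, hB⟩ := isTangle_split hD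
    have := (Iso.exchange l₂ (ho a) x.isTangle).within l₁ r (A := A) (B := B) (x := []) (y := [])
      (by simpa [Slice.bottom] using hA) (by simpa [Slice.top] using hB)
    simpa [Point.insert] using this
  | strandRight A B l r₁ r₂ a x =>
    obtain ⟨hA, hB⟩ := isTangle_split hD
    have := (Iso.exchange r₁ x.isTangle (ho a)).within l r₂ (A := A) (B := B) (x := []) (y := [])
      (by simpa [Slice.bottom] using hA) (by simpa [Slice.top] using hB)
    simpa [Point.insert] using this.symm
  | cap A B l r a =>
    obtain ⟨hA, hB⟩ := isTangle_split hD
    have := (Iso.slide_cap hg a).within l r (A := A) (B := B) (x := []) (y := [])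
      (by simpa [Slice.bottom, Piece.bottom] using hA) (by simpa [Slice.top, Piece.top] using hB)
    simpa [Point.insert] using this
  | cup A B l r a =>
    rw [List.append_assoc] at hD
    obtain ⟨hA, hB⟩ := isTangle_split hD
    have := (Iso.slide_cup hg a).within l r (A := A) (B := B) (x := []) (y := [])
      (by simpa [Slice.bottom, Piece.bottom] using hA) (by simpa [Slice.top, Piece.top] using hB)
    simpa [Point.insert] using this
  | crossFirst A B l r o a b =>
    obtain ⟨hA, hB⟩ := isTangle_split hD
    have := (Iso.slide_cross_first o a b (ho a)).within l r (A := A) (B := B) (x := []) (y := [])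
      (by simpa [Slice.bottom, Piece.bottom] using hA) (by simpa [Slice.top, Piece.top] using hB)
    simpa [Point.insert] using this
  | crossSecond A B l r o a b =>
    obtain ⟨hA, hB⟩ := isTangle_split hD
    have := (Iso.slide_cross_second o a b (ho b)).within l r (A := A) (B := B) (x := []) (y := [])
      (by simpa [Slice.bottom, Piece.bottom] using hA) (by simpa [Slice.top, Piece.top] using hB)
    simpa [Point.insert] using this

theorem Point.isTangle_insert {g D : List Slice} (hg : IsTangle [true] g [true]) {p : Point}
    (hp : p.On D) (hD : IsTangle [] D []) : IsTangle [] (p.insert g) [] := by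
  obtain ⟨rfl, hp⟩ := hp
  obtain ⟨w, hA, hB⟩ := isTangle_append.1 hD
  obtain rfl := hA.top_unique hp
  have := (isTangle_orient hg p.dir).padded p.left p.right
  exact hA.append (IsTangle.append (by simpa using this) hB)

/-- If two points of a diagram lie on the same component, then a long knot can be inserted
at either of them. -/
theorem Point.insert_iso_of_eqvGen {g D : List Slice} (hg : IsTangle [true] g [true]) {p q : Point}
    (h : Relation.EqvGen Point.Link p q) (hp : p.On D) (hD : IsTangle [] D []) :
    Iso [] [] (p.insert g) (q.insert g) := by
  by_cases hpq : p = q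
  · subst hpq
    exact Iso.refl (isTangle_insert hg hp hD)
  have key : p = q ∨ (p.before ++ p.after = q.before ++ q.after ∧
      (IsTangle [] (p.before ++ p.after) [] → Iso [] [] (p.insert g) (q.insert g))) := by
    clear hp hpq
    induction h with
    | rel x y h => exact .inr ⟨h.before_append_after, h.insert_iso hg⟩
    | refl x => exact .inl rfl
    | symm x y _ ih =>
      refine ih.imp Eq.symm fun ⟨h, h'⟩ => ⟨h.symm, fun hx => (h' (h ▸ hx)).symm⟩
    | trans x y z _ _ ih₁ ih₂ =>
      rcases ih₁ with rfl | ⟨h₁, k₁⟩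
      · exact ih₂
      · rcases ih₂ with rfl | ⟨h₂, k₂⟩
        · exact .inr ⟨h₁, k₁⟩
        · exact .inr ⟨h₁.trans h₂, fun hx => (k₁ hx).trans (k₂ (h₁ ▸ hx))⟩
  exact (key.resolve_left hpq).2 (hp.1 ▸ hD)

/-- If the replaced part of a diagram has boundary, then there is a point on this boundary, and the
insertion of a long knot at this point commutes with the replacement. -/
theorem exists_point_of_replace {a b : List Bool} {t t' D D' : List Slice} (ht : IsTangle a t b)
    (ht' : IsTangle a t' b) (hne : t ≠ [] ∨ t' ≠ []) (hab : a ≠ [] ∨ b ≠ [])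
    (hD : IsTangle [] D []) (hD' : IsTangle [] D' []) (h : Replace t t' D D') :
    ∃ p p' : Point, p.On D ∧ p'.On D' ∧ ∀ g, Replace t t' (p.insert g) (p'.insert g) := by
  obtain ⟨A, B, l, r, rfl, rfl⟩ := h
  have hp := ht.padded l r
  have hp' := ht'.padded l r
  have hA : IsTangle [] A (l ++ a ++ r) := by
    rw [List.append_assoc] at hD hD'
    obtain ⟨w, hA, hw⟩ := isTangle_append.1 hD
    obtain ⟨w', hA', hw'⟩ := isTangle_append.1 hD'
    obtain rfl := hA.top_unique hA'
    obtain ⟨v, hv, -⟩ := isTangle_append.1 hw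
    obtain ⟨v', hv', -⟩ := isTangle_append.1 hw'
    rcases hne with hne | hne
    · rwa [hp.bottom_unique (by simpa [pad] using hne) hv]
    · rwa [hp'.bottom_unique (by simpa [pad] using hne) hv']
  rcases hab with hab | hab
  · obtain ⟨x, a, rfl⟩ := List.exists_cons_of_ne_nil hab
    have hA' : IsTangle [] A (l ++ x :: (a ++ r)) := by simpa using hA
    refine ⟨⟨A, l, x, a ++ r, pad l r t ++ B⟩, ⟨A, l, x, a ++ r, pad l r t' ++ B⟩,
      ⟨by simp, hA'⟩, ⟨by simp, hA'⟩,
      fun g => ⟨A ++ pad l (a ++ r) (orient g x), B, l, r, by simp [Point.insert],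
        by simp [Point.insert]⟩⟩
  · obtain ⟨x, b, rfl⟩ := List.exists_cons_of_ne_nil hab
    refine ⟨⟨A ++ pad l r t, l, x, b ++ r, B⟩, ⟨A ++ pad l r t', l, x, b ++ r, B⟩,
      ⟨by simp, by simpa using hA.append hp⟩, ⟨by simp, by simpa using hA.append hp'⟩,
      fun g => ⟨A, pad l (b ++ r) (orient g x) ++ B, l, r, by simp [Point.insert],
        by simp [Point.insert]⟩⟩

/-- Both sides of an elementary move are nonempty tangles with the same nonempty boundary, except
that the right-hand side may consist of vertical strands only. -/
theorem boundary_of_move {t t' : List Slice} (h : PlanarMove t t' ∨ ReidemeisterMove t t') :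
    ∃ a b, IsTangle a t b ∧ IsTangle a t' b ∧ t ≠ [] ∧ (a ≠ [] ∨ b ≠ []) := by
  rcases h with h | h
  · cases h with
    | exchange g h m =>
      refine ⟨g.bottom ++ m ++ h.bottom, g.top ++ m ++ h.top,
        by simp [IsTangle, Slice.bottom, Slice.top], by simp [IsTangle, Slice.bottom, Slice.top],
        by simp, ?_⟩
      cases g <;> simp [Piece.bottom, Piece.top]
    | zigzag a =>
      exact ⟨[a], [a], (Iso.zigzag a).left, (Iso.zigzag a).right, by simp, by simp⟩
    | zagzig a =>
      exact ⟨[a], [a], (Iso.zagzig a).left, (Iso.zagzig a).right, by simp, by simp⟩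
    | capCross o a b => exact ⟨_, _, (Iso.capCross o a b).left, (Iso.capCross o a b).right,
        by simp, by simp⟩
    | cupCross o a b => exact ⟨_, _, (Iso.cupCross o a b).left, (Iso.cupCross o a b).right,
        by simp, by simp⟩
  · cases h with
    | oneRight o a => exact ⟨_, _, (Iso.oneRight o a).left, (Iso.oneRight o a).right,
        by simp, by simp⟩
    | oneLeft o a =>
      exact ⟨[a], [a], by cases a <;> exact ⟨rfl, rfl, rfl, rfl⟩, rfl, by simp, by simp⟩
    | two o a b => exact ⟨_, _, (Iso.two o a b).left, (Iso.two o a b).right, by simp, by simp⟩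
    | three o p q a b c h => exact ⟨_, _, (Iso.three o p q a b c h).left,
        (Iso.three o p q a b c h).right, by simp, by simp⟩

/-! ### Colourings of diagrams -/

/-- The colours at the top of a piece whose strands are coloured with two colours, for given
colours at the bottom. The result is a multiset, since a minimum can have either colour. -/
def Piece.colour : Piece → List Bool → Multiset (List Bool)
  | .cap _, [x, y] => if x = y then {[]} else 0
  | .cup _, [] => {[false, false], [true, true]}
  | .cross _ _ _, [x, y] => {[y, x]}
  | _, _ => 0

/-- The colours at the top of a coloured slice, for given colours at the bottom. -/
def Slice.colour (s : Slice) (w : List Bool) : Multiset (List Bool) :=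
  (s.piece.colour ((w.drop s.left.length).take s.piece.bottom.length)).map fun v =>
    w.take s.left.length ++ (v ++ w.drop (s.left.length + s.piece.bottom.length))

/-- The colours at the top of a coloured diagram, for given colours at the bottom. The multiplicity
is the number of colourings with the given boundary. -/
def run : List Slice → List Bool → Multiset (List Bool)
  | [], w => {w}
  | s :: d, w => (s.colour w).bind (run d)

theorem run_append (d e : List Slice) (w : List Bool) :
    run (d ++ e) w = (run d w).bind (run e) := by
  induction d generalizing w with
  | nil => simp [run]
  | cons s d ih =>
    simp only [List.cons_append, run, Multiset.bind_assoc]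
    exact Multiset.bind_congr fun w' _ => ih w'

theorem Slice.colour_eq (l r : List Bool) (g : Piece) {u v w : List Bool}
    (hu : u.length = l.length) (hv : v.length = g.bottom.length) :
    Slice.colour ⟨l, g, r⟩ (u ++ (v ++ w)) = (g.colour v).map fun v' => u ++ (v' ++ w) := by
  simp [Slice.colour, ← hu, ← hv]

theorem exists_append_of_length {α : Type*} {w : List α} {m n : ℕ} (h : w.length = m + n) :
    ∃ u v, w = u ++ v ∧ u.length = m ∧ v.length = n :=
  ⟨w.take m, w.drop m, by simp, by simp [h], by simp [h]⟩

theorem Piece.length_of_mem_colour {g : Piece} {v v' : List Bool} (h : v' ∈ g.colour v) :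
    v'.length = g.top.length := by
  unfold Piece.colour at h
  split at h
  · split_ifs at h <;> simp_all [Piece.top]
  · simp at h
    rcases h with rfl | rfl <;> rfl
  · simp at h
    subst h; rfl
  · simp at h

/-- The colours at the bottom and at the top of a coloured slice agree on the vertical strands. -/
theorem Slice.exists_of_mem_colour {s : Slice} {w w' : List Bool}
    (hw : w.length = s.bottom.length) (h : w' ∈ s.colour w) :
    ∃ u v v' z, w = u ++ (v ++ z) ∧ w' = u ++ (v' ++ z) ∧ v' ∈ s.piece.colour v ∧
      u.length = s.left.length ∧ v.length = s.piece.bottom.length ∧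
      v'.length = s.piece.top.length ∧ z.length = s.right.length := by
  obtain ⟨l, g, r⟩ := s
  obtain ⟨u, x, rfl, hu, hx⟩ := exists_append_of_length (w := w) (m := l.length)
    (n := g.bottom.length + r.length) (by simp [hw, Slice.bottom])
  obtain ⟨v, z, rfl, hv, hz⟩ := exists_append_of_length hx
  rw [Slice.colour_eq l r g hu hv, Multiset.mem_map] at h
  obtain ⟨v', hv', rfl⟩ := h
  exact ⟨u, v, v', z, rfl, rfl, hv', hu, hv, Piece.length_of_mem_colour hv', hz⟩

theorem Slice.length_of_mem_colour {s : Slice} {w w' : List Bool}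
    (hw : w.length = s.bottom.length) (h : w' ∈ s.colour w) : w'.length = s.top.length := by
  obtain ⟨u, v, v', z, rfl, rfl, -, h₁, h₂, h₃, h₄⟩ := Slice.exists_of_mem_colour hw h
  simp [Slice.top, *]

theorem length_of_mem_run {a b : List Bool} {d : List Slice} (hd : IsTangle a d b)
    {w w' : List Bool} (hw : w.length = a.length) (h : w' ∈ run d w) : w'.length = b.length := by
  induction d generalizing a w with
  | nil =>
    cases hd
    simp only [run, Multiset.mem_singleton] at h
    rwa [h]
  | cons s d ih =>
    obtain ⟨rfl, hd⟩ := hd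
    obtain ⟨x, hx, hx'⟩ := Multiset.mem_bind.1 h
    exact ih hd (Slice.length_of_mem_colour hw hx) hx'

theorem run_pad (l r : List Bool) {a b : List Bool} {d : List Slice} (hd : IsTangle a d b)
    {u v w : List Bool} (hu : u.length = l.length) (hv : v.length = a.length) :
    run (pad l r d) (u ++ (v ++ w)) = (run d v).map fun v' => u ++ (v' ++ w) := by
  induction d generalizing a v with
  | nil => simp [run]
  | cons s d ih =>
    obtain ⟨rfl, hd⟩ := hd
    obtain ⟨l', g, r'⟩ := s
    obtain ⟨u', x, rfl, hu', hx⟩ := exists_append_of_length (w := v) (m := l'.length)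
      (n := g.bottom.length + r'.length) (by simp [hv, Slice.bottom])
    obtain ⟨v', z, rfl, hv', hz⟩ := exists_append_of_length hx
    have h₁ := Slice.colour_eq (l ++ l') (r' ++ r) g (u := u ++ u') (v := v') (w := z ++ w)
      (by simp [hu, hu']) hv'
    have h₂ := Slice.colour_eq l' r' g (u := u') (v := v') (w := z) hu' hv'
    simp only [List.append_assoc] at h₁
    simp only [pad_cons, run, List.append_assoc, h₁, h₂, Multiset.bind_map, Multiset.map_bind]
    refine Multiset.bind_congr fun y hy => ?_
    have := ih hd (v := u' ++ (y ++ z))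
      (by simp [Slice.top, hu', hz, Piece.length_of_mem_colour hy])
    simpa using this

/-- Elementary moves preserve the number of colourings with given boundary. -/
theorem run_eq_of_move {t t' : List Slice} (h : PlanarMove t t' ∨ ReidemeisterMove t t')
    {a b : List Bool} (ht : IsTangle a t b) {v : List Bool} (hv : v.length = a.length) :
    run t v = run t' v := by
  rcases h with h | h
  · cases h with
    | exchange g h m =>
      obtain ⟨rfl, -⟩ := ht
      obtain ⟨v₁, x, rfl, h₁, hx⟩ := exists_append_of_length (m := g.bottom.length)
        (n := m.length + h.bottom.length) (by simpa [Slice.bottom] using hv)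
      obtain ⟨y, v₂, rfl, hy, h₂⟩ := exists_append_of_length hx
      have k₁ := Slice.colour_eq [] (m ++ h.bottom) g (u := []) (w := y ++ v₂) rfl h₁
      have k₂ := Slice.colour_eq (g.bottom ++ m) [] h (u := v₁ ++ y) (w := []) (by simp [h₁, hy]) h₂
      have k₃ : ∀ u ∈ g.colour v₁, run [⟨g.top ++ m, h, []⟩] (u ++ (y ++ v₂)) =
          (h.colour v₂).map fun u' => u ++ (y ++ u') := by
        intro u hu
        have := Slice.colour_eq (g.top ++ m) [] h (u := u ++ y) (w := [])
          (by simp [Piece.length_of_mem_colour hu, hy]) h₂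
        simp only [List.append_assoc, List.append_nil] at this
        rw [run, this]
        exact (Multiset.bind_singleton _ fun x => x).trans (Multiset.map_id' _)
      have k₄ : ∀ u ∈ h.colour v₂, run [⟨[], g, m ++ h.top⟩] (v₁ ++ (y ++ u)) =
          (g.colour v₁).map fun u' => u' ++ (y ++ u) := by
        intro u hu
        have := Slice.colour_eq [] (m ++ h.top) g (u := []) (w := y ++ u) rfl h₁
        simp only [List.nil_append] at this
        rw [run, this]
        exact (Multiset.bind_singleton _ fun x => x).trans (Multiset.map_id' _)
      simp only [List.append_assoc, List.append_nil, List.nil_append] at k₁ k₂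
      rw [run, k₁, run, k₂, Multiset.bind_map, Multiset.bind_map, Multiset.bind_congr k₃,
        Multiset.bind_congr k₄, Multiset.bind_map_comm]
    | zigzag a =>
      obtain ⟨rfl, -⟩ := ht
      match v, hv with
      | [x], _ => cases x <;> rfl
    | zagzig a =>
      obtain ⟨rfl, -⟩ := ht
      match v, hv with
      | [x], _ => cases x <;> rfl
    | capCross o a b =>
      obtain ⟨rfl, -⟩ := ht
      match v, hv with
      | [x, y, z], _ => cases x <;> cases y <;> cases z <;> rfl
    | cupCross o a b =>
      obtain ⟨rfl, -⟩ := ht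
      match v, hv with
      | [x], _ => cases x <;> rfl
  · cases h with
    | oneRight o a =>
      obtain ⟨rfl, -⟩ := ht
      match v, hv with
      | [x], _ => cases x <;> rfl
    | oneLeft o a =>
      obtain ⟨rfl, -⟩ := ht
      match v, hv with
      | [x], _ => cases x <;> rfl
    | two o a b =>
      obtain ⟨rfl, -⟩ := ht
      match v, hv with
      | [x, y], _ => rfl
    | three o p q a b c h =>
      obtain ⟨rfl, -⟩ := ht
      match v, hv with
      | [x, y, z], _ => rfl

/-- The number of colourings is invariant under planar isotopy and Reidemeister moves. -/
theorem run_eq_of_step {a b : List Bool} {D D' : Tangle a b} (h : Step D D') {w : List Bool}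
    (hw : w.length = a.length) : run D.1 w = run D'.1 w := by
  obtain ⟨t, t', hm, A, B, l, r, h₁, h₂⟩ := h
  obtain ⟨x, y, ht, ht', hne, -⟩ := boundary_of_move hm
  have hD := D.2
  rw [h₁, List.append_assoc] at hD
  obtain ⟨z, hA, hz⟩ := isTangle_append.1 hD
  obtain ⟨z', hz, -⟩ := isTangle_append.1 hz
  obtain rfl := (ht.padded l r).bottom_unique (by simpa [pad] using hne) hz
  rw [h₁, h₂, List.append_assoc, List.append_assoc]
  simp only [run_append]
  refine Multiset.bind_congr fun w' hw' => ?_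
  have hl := length_of_mem_run hA hw hw'
  obtain ⟨u, k, rfl, hu, hk⟩ := exists_append_of_length (w := w') (m := l.length)
    (n := x.length + r.length) (by simp [hl])
  obtain ⟨v, s, rfl, hv, -⟩ := exists_append_of_length hk
  rw [run_pad l r ht hu hv, run_pad l r ht' hu hv, run_eq_of_move hm ht hv]

/-! ### Knot diagrams have exactly two colourings -/

/-- The colourings of a diagram with given colours at the bottom, where a colouring is recorded as
the list of the words of colours on all levels. -/
def colourings : List Slice → List Bool → Multiset (List (List Bool))
  | [], w => {[w]}
  | s :: d, w => (s.colour w).bind fun w' => (colourings d w').map (w :: ·)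

theorem card_colourings (d : List Slice) (w : List Bool) :
    (colourings d w).card = (run d w).card := by
  induction d generalizing w with
  | nil => simp [colourings, run]
  | cons s d ih => simp [colourings, run, Multiset.card_bind, ih]

theorem mem_colourings_cons {s : Slice} {d : List Slice} {w : List Bool} {c : List (List Bool)} :
    c ∈ colourings (s :: d) w ↔ ∃ w' ∈ s.colour w, ∃ c' ∈ colourings d w', w :: c' = c := by
  simp [colourings]

theorem exists_cons_of_mem_colourings {d : List Slice} {w : List Bool} {c : List (List Bool)}
    (h : c ∈ colourings d w) : ∃ c', c = w :: c' := by
  cases d with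
  | nil => exact ⟨[], by simpa [colourings] using h⟩
  | cons s d =>
    obtain ⟨w', -, c', -, rfl⟩ := mem_colourings_cons.1 h
    exact ⟨c', rfl⟩

theorem Piece.nodup_colour (g : Piece) (v : List Bool) : (g.colour v).Nodup := by
  unfold Piece.colour
  split
  · split_ifs <;> simp
  · simp
  · simp
  · simp

theorem Slice.nodup_colour (s : Slice) (w : List Bool) : (s.colour w).Nodup := by
  refine (Piece.nodup_colour _ _).map ?_
  intro x y h
  simpa using h

theorem nodup_colourings (d : List Slice) (w : List Bool) : (colourings d w).Nodup := by
  induction d generalizing w with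
  | nil => simp [colourings]
  | cons s d ih =>
    rw [colourings, Multiset.nodup_bind]
    refine ⟨fun w' _ => (ih w').map (List.cons_injective), ?_⟩
    refine (s.nodup_colour w).pairwise ?_
    intro x _ y _ hxy
    rw [Function.onFun, Multiset.disjoint_left]
    intro c hx hy
    obtain ⟨c₁, h₁, rfl⟩ := Multiset.mem_map.1 hx
    obtain ⟨c₂, h₂, h⟩ := Multiset.mem_map.1 hy
    obtain ⟨e₁, rfl⟩ := exists_cons_of_mem_colourings h₁
    obtain ⟨e₂, rfl⟩ := exists_cons_of_mem_colourings h₂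
    simp only [List.cons.injEq] at h
    exact hxy h.2.1.symm

/-- The colour of a point in a colouring. -/
def Point.colour (c : List (List Bool)) (p : Point) : Bool :=
  (c.getD p.before.length []).getD p.left.length false

/-- Consecutive words of a colouring satisfy the colouring rule at the slice between them. -/
theorem getD_mem_colour {A B : List Slice} {s : Slice} {w : List Bool} {c : List (List Bool)}
    (h : c ∈ colourings (A ++ s :: B) w) :
    c.getD (A.length + 1) [] ∈ s.colour (c.getD A.length []) := by
  induction A generalizing w c with
  | nil =>
    obtain ⟨w', hw', c', hc', rfl⟩ := mem_colourings_cons.1 h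
    obtain ⟨e, rfl⟩ := exists_cons_of_mem_colourings hc'
    simpa using hw'
  | cons x A ih =>
    obtain ⟨w', hw', c', hc', rfl⟩ := mem_colourings_cons.1 h
    simpa using ih hc'

theorem length_getD_of_mem_colourings {a b : List Bool} {A B : List Slice} {w : List Bool}
    {c : List (List Bool)} (hA : IsTangle a A b) (hw : w.length = a.length) (h : c ∈ colourings (A ++ B) w) :
    (c.getD A.length []).length = b.length := by
  induction A generalizing a w c with
  | nil =>
    cases hA
    obtain ⟨e, rfl⟩ := exists_cons_of_mem_colourings h
    simpa using hw
  | cons x A ih =>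
    obtain ⟨w', hw', c', hc', rfl⟩ := mem_colourings_cons.1 h
    obtain ⟨rfl, hA⟩ := hA
    simpa using ih hA (Slice.length_of_mem_colour hw hw') hc'

/-- A colouring is constant along the arcs of a diagram. -/
theorem Point.Link.colour_eq {p q : Point} (h : Point.Link p q)
    (hD : IsTangle [] (p.before ++ p.after) []) {c : List (List Bool)}
    (hc : c ∈ colourings (p.before ++ p.after) []) : p.colour c = q.colour c := by
  have key : ∀ (A B : List Slice) (l r : List Bool) (g : Piece),
      IsTangle [] (A ++ ⟨l, g, r⟩ :: B) [] → c ∈ colourings (A ++ ⟨l, g, r⟩ :: B) [] →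
      ∃ u v v' z, c.getD A.length [] = u ++ (v ++ z) ∧
        c.getD (A.length + 1) [] = u ++ (v' ++ z) ∧ v' ∈ g.colour v ∧
        u.length = l.length ∧ v.length = g.bottom.length ∧ v'.length = g.top.length ∧
        z.length = r.length := by
    intro A B l r g hD hc
    exact Slice.exists_of_mem_colour (length_getD_of_mem_colourings (isTangle_split hD).1 rfl hc)
      (getD_mem_colour hc)
  cases h with
  | strandLeft A B l₁ l₂ r a g =>
    obtain ⟨u, v, v', z, h₁, h₂, hv, hu, hv₁, hv₂, hz⟩ := key _ _ _ _ _ hD hc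
    have : l₁.length < u.length := by simp [hu]
    simp only [Point.colour, List.length_append, List.length_singleton, h₁, h₂]
    rw [List.getD_append _ _ _ _ this, List.getD_append _ _ _ _ this]
  | strandRight A B l r₁ r₂ a g =>
    obtain ⟨u, v, v', z, h₁, h₂, hv, hu, hv₁, hv₂, hz⟩ := key _ _ _ _ _ hD hc
    simp only [Point.colour, List.length_append, List.length_singleton, h₁, h₂]
    rw [← List.append_assoc, ← List.append_assoc, List.getD_append_right _ _ _ _ (by simp; omega),
      List.getD_append_right _ _ _ _ (by simp; omega)]
    congr 1
    simp; omega
  | cap A B l r a =>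
    obtain ⟨u, v, v', z, h₁, h₂, hv, hu, hv₁, hv₂, hz⟩ := key _ _ _ _ _ hD hc
    match v, hv₁ with
    | [x, y], _ =>
      have hxy : x = y := by
        by_contra hxy
        simp [Piece.colour, hxy] at hv
      simp only [Point.colour, List.length_append, List.length_singleton, h₁]
      simp [← hu, hxy]
  | cup A B l r a =>
    simp only [List.append_assoc, List.cons_append, List.nil_append] at hD hc
    obtain ⟨u, v, v', z, h₁, h₂, hv, hu, hv₁, hv₂, hz⟩ := key _ _ _ _ _ hD hc
    match v, hv₁ with
    | [], _ =>
      simp only [Piece.colour, Multiset.insert_eq_cons, Multiset.mem_cons,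
        Multiset.mem_singleton] at hv
      simp only [Point.colour, List.length_append, List.length_singleton, h₂]
      rcases hv with rfl | rfl <;> simp [← hu]
  | crossFirst A B l r o a b =>
    obtain ⟨u, v, v', z, h₁, h₂, hv, hu, hv₁, hv₂, hz⟩ := key _ _ _ _ _ hD hc
    match v, hv₁ with
    | [x, y], _ =>
      simp only [Piece.colour, Multiset.mem_singleton] at hv
      subst hv
      simp only [Point.colour, List.length_append, List.length_singleton, h₁, h₂]
      simp [← hu]
  | crossSecond A B l r o a b =>
    obtain ⟨u, v, v', z, h₁, h₂, hv, hu, hv₁, hv₂, hz⟩ := key _ _ _ _ _ hD hc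
    match v, hv₁ with
    | [x, y], _ =>
      simp only [Piece.colour, Multiset.mem_singleton] at hv
      subst hv
      simp only [Point.colour, List.length_append, List.length_singleton, h₁, h₂]
      simp [← hu]

theorem Point.colour_eq_of_eqvGen {D : List Slice} (hD : IsTangle [] D []) {p q : Point}
    (h : Relation.EqvGen Point.Link p q) (hp : p.On D) {c : List (List Bool)}
    (hc : c ∈ colourings D []) : p.colour c = q.colour c := by
  have key : p.before ++ p.after = q.before ++ q.after ∧
      (p.before ++ p.after = D → p.colour c = q.colour c) := by
    clear hp
    induction h with
    | rel x y h => exact ⟨h.before_append_after, by rintro rfl; exact h.colour_eq hD hc⟩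
    | refl x => exact ⟨rfl, fun _ => rfl⟩
    | symm x y _ ih => exact ⟨ih.1.symm, fun h => (ih.2 (ih.1.trans h)).symm⟩
    | trans x y z _ _ ih₁ ih₂ =>
      exact ⟨ih₁.1.trans ih₂.1, fun h => (ih₁.2 h).trans (ih₂.2 (ih₁.1.symm.trans h))⟩
  exact key.2 hp.1.symm

/-- The colouring of a diagram in a single colour. -/
def constColouring (x : Bool) : List Bool → List Slice → List (List Bool)
  | a, [] => [List.replicate a.length x]
  | a, s :: d => List.replicate a.length x :: constColouring x s.top d

theorem replicate_mem_colour (x : Bool) (s : Slice) :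
    List.replicate s.top.length x ∈ s.colour (List.replicate s.bottom.length x) := by
  obtain ⟨l, g, r⟩ := s
  have h : List.replicate g.top.length x ∈ g.colour (List.replicate g.bottom.length x) := by
    cases g <;> cases x <;> simp [Piece.top, Piece.bottom, Piece.colour, List.replicate]
  have := Slice.colour_eq l r g (u := List.replicate l.length x)
    (v := List.replicate g.bottom.length x) (w := List.replicate r.length x) (by simp) (by simp)
  simp only [Slice.top, Slice.bottom, List.length_append, List.replicate_add, List.append_assoc,
    this]
  exact Multiset.mem_map.2 ⟨_, h, rfl⟩

theorem constColouring_mem (x : Bool) {a b : List Bool} {d : List Slice} (hd : IsTangle a d b) :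
    constColouring x a d ∈ colourings d (List.replicate a.length x) := by
  induction d generalizing a with
  | nil => simp [constColouring, colourings]
  | cons s d ih =>
    obtain ⟨rfl, hd⟩ := hd
    exact mem_colourings_cons.2 ⟨_, replicate_mem_colour x s, _, ih hd, rfl⟩

theorem replicate_mem_run (x : Bool) {a b : List Bool} {d : List Slice} (hd : IsTangle a d b) :
    List.replicate b.length x ∈ run d (List.replicate a.length x) := by
  induction d generalizing a with
  | nil => cases hd; simp [run]
  | cons s d ih =>
    obtain ⟨rfl, hd⟩ := hd
    exact Multiset.mem_bind.2 ⟨_, replicate_mem_colour x s, ih hd⟩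

theorem constColouring_getD (x : Bool) {a b : List Bool} {A B : List Slice}
    (hA : IsTangle a A b) :
    (constColouring x a (A ++ B)).getD A.length [] = List.replicate b.length x := by
  induction A generalizing a with
  | nil =>
    cases hA
    cases B <;> simp [constColouring]
  | cons s A ih => simpa [constColouring] using ih hA.2

theorem Point.colour_constColouring (x : Bool) {p : Point} {D : List Slice} (hp : p.On D) :
    p.colour (constColouring x [] D) = x := by
  obtain ⟨rfl, hp⟩ := hp
  rw [Point.colour, constColouring_getD x hp]
  simp [List.getD_eq_getElem?_getD]

/-- A colouring that has the colour `x` at all points is the colouring in the colour `x`. -/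
theorem eq_constColouring (x : Bool) {a b : List Bool} {d : List Slice} (hd : IsTangle a d b)
    {w : List Bool} (hw : w.length = a.length) {c : List (List Bool)} (hc : c ∈ colourings d w)
    (h : ∀ A l y r B, d = A ++ B → IsTangle a A (l ++ y :: r) →
      (c.getD A.length []).getD l.length false = x) : c = constColouring x a d := by
  have hwx : w = List.replicate a.length x := by
    obtain ⟨e, rfl⟩ := exists_cons_of_mem_colourings hc
    refine List.ext_getElem (by simp [hw]) fun i h₁ h₂ => ?_
    have hi : i < a.length := hw ▸ h₁
    have := h [] (a.take i) a[i] (a.drop (i + 1)) d rfl (by simp [IsTangle])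
    simp only [List.length_nil, List.getD_cons_zero, List.length_take, min_eq_left hi.le] at this
    rw [List.getD_eq_getElem _ _ h₁] at this
    simpa using this
  induction d generalizing a w c with
  | nil => simpa [colourings, constColouring, hwx] using hc
  | cons s d ih =>
    obtain ⟨w', hw', c', hc', rfl⟩ := mem_colourings_cons.1 hc
    obtain ⟨rfl, hd⟩ := hd
    have hl := Slice.length_of_mem_colour hw hw'
    have h' : ∀ A l y r B, d = A ++ B → IsTangle s.top A (l ++ y :: r) →
        (c'.getD A.length []).getD l.length false = x := by
      intro A l y r B hAB hA
      have := h (s :: A) l y r B (by simp [hAB]) ⟨rfl, hA⟩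
      simpa using this
    rw [constColouring, ← hwx]
    refine congrArg _ (ih hd hl hc' h' ?_)
    obtain ⟨e, rfl⟩ := exists_cons_of_mem_colourings hc'
    refine List.ext_getElem (by simp [hl]) fun i h₁ h₂ => ?_
    have hi : i < s.top.length := hl ▸ h₁
    have := h' [] (s.top.take i) s.top[i] (s.top.drop (i + 1)) d rfl (by simp [IsTangle])
    simp only [List.length_nil, List.getD_cons_zero, List.length_take, min_eq_left hi.le] at this
    rw [List.getD_eq_getElem _ _ h₁] at this
    simpa using this

/-- The values of a function on points at the strands `m` of a level of a diagram, where `l` and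
`r` are the strands to the left and to the right of `m`. -/
def levelColours (χ : Point → Bool) (A B : List Slice) : List Bool → List Bool → List Bool →
    List Bool
  | _, [], _ => []
  | l, x :: m, r => χ ⟨A, l, x, m ++ r, B⟩ :: levelColours χ A B (l ++ [x]) m r

theorem levelColours_append (χ : Point → Bool) (A B : List Slice) (l m m' r : List Bool) :
    levelColours χ A B l (m ++ m') r =
      levelColours χ A B l m (m' ++ r) ++ levelColours χ A B (l ++ m) m' r := by
  induction m generalizing l with
  | nil => simp [levelColours]
  | cons x m ih => simp [levelColours, ih]

@[simp] theorem length_levelColours (χ : Point → Bool) (A B : List Slice) (l m r : List Bool) :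
    (levelColours χ A B l m r).length = m.length := by
  induction m generalizing l with
  | nil => rfl
  | cons x m ih => simp [levelColours, ih]

theorem levelColours_congr {χ : Point → Bool} {A B A' B' : List Slice} {l r l' r' m : List Bool}
    (h : ∀ m₁ x m₂, m = m₁ ++ x :: m₂ →
      χ ⟨A, l ++ m₁, x, m₂ ++ r, B⟩ = χ ⟨A', l' ++ m₁, x, m₂ ++ r', B'⟩) :
    levelColours χ A B l m r = levelColours χ A' B' l' m r' := by
  induction m generalizing l l' with
  | nil => rfl
  | cons x m ih =>
    have h₀ := h [] x m rfl
    simp only [List.append_nil] at h₀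
    rw [levelColours, levelColours, h₀]
    refine congrArg _ (ih fun m₁ y m₂ hm => ?_)
    simpa using h (x :: m₁) y m₂ (by simp [hm])

/-- The colouring of a diagram by a function on points. -/
def colouringOf (χ : Point → Bool) : List Slice → List Bool → List Slice → List (List Bool)
  | A, a, [] => [levelColours χ A [] [] a []]
  | A, a, s :: d => levelColours χ A (s :: d) [] a [] :: colouringOf χ (A ++ [s]) s.top d

/-- A function on points that is constant along arcs satisfies the colouring rule at every slice. -/
theorem levelColours_mem_colour {χ : Point → Bool} (hχ : ∀ p q, Point.Link p q → χ p = χ q)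
    (A B : List Slice) (s : Slice) :
    levelColours χ (A ++ [s]) B [] s.top [] ∈
      s.colour (levelColours χ A (s :: B) [] s.bottom []) := by
  obtain ⟨l, g, r⟩ := s
  have hl : levelColours χ (A ++ [⟨l, g, r⟩]) B [] l (g.top ++ r) =
      levelColours χ A (⟨l, g, r⟩ :: B) [] l (g.bottom ++ r) := by
    refine levelColours_congr ?_
    rintro m₁ x m₂ rfl
    have := hχ _ _ (.strandLeft A B m₁ m₂ r x g)
    simpa using this.symm
  have hr : levelColours χ (A ++ [⟨l, g, r⟩]) B (l ++ g.top) r [] =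
      levelColours χ A (⟨l, g, r⟩ :: B) (l ++ g.bottom) r [] := by
    refine levelColours_congr ?_
    rintro m₁ x m₂ rfl
    have := hχ _ _ (.strandRight A B l m₁ m₂ x g)
    simpa using this.symm
  have hm : levelColours χ (A ++ [⟨l, g, r⟩]) B l g.top r ∈
      g.colour (levelColours χ A (⟨l, g, r⟩ :: B) l g.bottom r) := by
    cases g with
    | cap a =>
      have := hχ _ _ (.cap A B l r a)
      simp [Piece.top, Piece.bottom, levelColours, Piece.colour, this]
    | cup a =>
      have := hχ _ _ (.cup A B l r a)
      cases h : χ ⟨A ++ [⟨l, .cup a, r⟩], l ++ [a], !a, r, B⟩ <;>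
        simp [Piece.top, Piece.bottom, levelColours, Piece.colour, this, h]
    | cross o a b =>
      have h₁ := hχ _ _ (.crossFirst A B l r o a b)
      have h₂ := hχ _ _ (.crossSecond A B l r o a b)
      simp [Piece.top, Piece.bottom, levelColours, Piece.colour, h₁, h₂]
  simp only [Slice.top, Slice.bottom, List.append_assoc, levelColours_append, List.nil_append,
    List.append_nil]
  rw [Slice.colour_eq l r g (by simp) (by simp)]
  exact Multiset.mem_map.2 ⟨_, hm, by rw [hl, hr]⟩

theorem colouringOf_mem {χ : Point → Bool} (hχ : ∀ p q, Point.Link p q → χ p = χ q)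
    (A : List Slice) {a b : List Bool} {d : List Slice} (hd : IsTangle a d b) :
    colouringOf χ A a d ∈ colourings d (levelColours χ A d [] a []) := by
  induction d generalizing A a with
  | nil => simp [colouringOf, colourings]
  | cons s d ih =>
    obtain ⟨rfl, hd⟩ := hd
    exact mem_colourings_cons.2 ⟨_, levelColours_mem_colour hχ A d s, _, ih (A ++ [s]) hd, rfl⟩

theorem colouringOf_getD (χ : Point → Bool) (A₀ : List Slice) {a b : List Bool}
    {A B : List Slice} (hA : IsTangle a A b) :
    (colouringOf χ A₀ a (A ++ B)).getD A.length [] = levelColours χ (A₀ ++ A) B [] b [] := by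
  induction A generalizing A₀ a with
  | nil =>
    cases hA
    cases B <;> simp [colouringOf]
  | cons s A ih => simpa [colouringOf] using ih (A₀ ++ [s]) hA.2

theorem Point.colour_colouringOf (χ : Point → Bool) {p : Point} {D : List Slice} (hp : p.On D) :
    p.colour (colouringOf χ [] [] D) = χ p := by
  obtain ⟨rfl, hp⟩ := hp
  rw [Point.colour, colouringOf_getD χ [] hp, levelColours_append,
    List.getD_append_right _ _ _ _ (by simp)]
  simp [levelColours]

theorem exists_point_of_ne_nil {D : List Slice} (hD : IsTangle [] D []) (hne : D ≠ []) :
    ∃ p : Point, p.On D := by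
  match D, hne, hD with
  | ⟨l, g, r⟩ :: d, _, hD =>
    obtain ⟨h, -⟩ := hD
    simp only [Slice.bottom, List.append_eq_nil_iff] at h
    obtain ⟨⟨rfl, h⟩, rfl⟩ := h
    cases g with
    | cup a => exact ⟨⟨[⟨[], .cup a, []⟩], [], a, [!a], d⟩, rfl, rfl, rfl⟩
    | cap a => simp [Piece.bottom] at h
    | cross o a b => simp [Piece.bottom] at h

/-- A diagram is a knot diagram if and only if it has exactly two colourings. -/
theorem isKnotDiagram_iff (D : Tangle [] []) : IsKnotDiagram D ↔ (run D.1 []).card = 2 := by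
  obtain ⟨D, hD⟩ := D
  rw [← card_colourings]
  have hmem : ∀ x, constColouring x [] D ∈ colourings D [] := fun x => constColouring_mem x hD
  have hnd : ∀ p : Point, p.On D →
      ({constColouring true [] D, constColouring false [] D} : Multiset _).Nodup := by
    intro p hp
    have : constColouring true [] D ≠ constColouring false [] D := by
      intro h
      have h₁ := Point.colour_constColouring true hp
      rw [h, Point.colour_constColouring false hp] at h₁
      simp at h₁
    simpa using this
  constructor
  · rintro ⟨⟨p, hp⟩, h⟩
    have : colourings D [] = {constColouring true [] D, constColouring false [] D} := by
      refine (Multiset.Nodup.ext (nodup_colourings _ _) (hnd p hp)).2 fun c => ⟨fun hc => ?_, ?_⟩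
      · have hx : c = constColouring (p.colour c) [] D := by
          refine eq_constColouring _ hD rfl hc ?_
          rintro A l y r B rfl hA
          have hq : Point.On ⟨A, l, y, r, B⟩ (A ++ B) := ⟨rfl, hA⟩
          exact Point.colour_eq_of_eqvGen hD (h _ p hq hp) hq hc
        rw [hx]
        cases p.colour c <;> simp
      · intro hc
        simp only [Multiset.insert_eq_cons, Multiset.mem_cons, Multiset.mem_singleton] at hc
        rcases hc with rfl | rfl
        exacts [hmem true, hmem false]
    rw [this]
    rfl
  · intro hcard
    have hne : D ≠ [] := by
      rintro rfl
      simp [colourings] at hcard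
    obtain ⟨p₀, hp₀⟩ := exists_point_of_ne_nil hD hne
    refine ⟨⟨p₀, hp₀⟩, fun p q hp hq => ?_⟩
    have hall : ({constColouring true [] D, constColouring false [] D} : Multiset _) =
        colourings D [] := by
      refine Multiset.eq_of_le_of_card_le ((Multiset.le_iff_subset (hnd p hp)).2 ?_)
        (by rw [hcard]; rfl)
      intro c hc
      simp only [Multiset.insert_eq_cons, Multiset.mem_cons, Multiset.mem_singleton] at hc
      rcases hc with rfl | rfl
      exacts [hmem true, hmem false]
    classical
    -- Colour the component of `p` in one colour and all other components in the other one.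
    let χ : Point → Bool := fun z => decide (Relation.EqvGen Point.Link p z)
    have hχ : ∀ y z, Point.Link y z → χ y = χ z := fun y z hyz =>
      decide_eq_decide.2 ⟨fun h => .trans _ _ _ h (.rel _ _ hyz),
        fun h => .trans _ _ _ h (.symm _ _ (.rel _ _ hyz))⟩
    have hc : colouringOf χ [] [] D ∈ colourings D [] := colouringOf_mem hχ [] hD
    have h₁ := Point.colour_colouringOf χ hp
    have h₂ := Point.colour_colouringOf χ hq
    have hp' : χ p = true := decide_eq_true (.refl p)
    have hq' : χ q = true := by
      rw [← hall] at hc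
      simp only [Multiset.insert_eq_cons, Multiset.mem_cons, Multiset.mem_singleton] at hc
      rcases hc with hc | hc
      · rw [← h₂, hc, Point.colour_constColouring true hq]
      · rw [hc, Point.colour_constColouring false hp, hp'] at h₁
        simp at h₁
    exact of_decide_eq_true hq'

/-! ### Closures of long knots -/

theorem isTangle_closure {f : List Slice} (hf : IsTangle [true] f [true]) :
    IsTangle [] (closure f) [] :=
  ⟨rfl, (hf.padded [] [false]).append ⟨rfl, rfl⟩⟩

/-- The closure of a diagram on one upward strand, as a diagram without boundary. -/
def closed {f : List Slice} (hf : IsTangle [true] f [true]) : Tangle [] [] :=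
  ⟨closure f, isTangle_closure hf⟩

theorem Piece.count_of_mem_colour {g : Piece} {v v' : List Bool} (h : v' ∈ g.colour v) :
    v'.count true % 2 = v.count true % 2 := by
  unfold Piece.colour at h
  split at h
  · rename_i x y
    split_ifs at h with hxy
    · subst hxy
      rw [Multiset.mem_singleton] at h
      subst h
      cases x <;> rfl
    · simp at h
  · simp only [Multiset.insert_eq_cons, Multiset.mem_cons, Multiset.mem_singleton] at h
    rcases h with rfl | rfl <;> rfl
  · rename_i x y
    rw [Multiset.mem_singleton] at h
    subst h
    cases x <;> cases y <;> rfl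
  · simp at h

/-- The parity of the number of strands of the colour `true` is the same at the bottom and at the top
of a coloured diagram. -/
theorem count_of_mem_run {a b : List Bool} {d : List Slice} (hd : IsTangle a d b)
    {w w' : List Bool} (hw : w.length = a.length) (h : w' ∈ run d w) :
    w'.count true % 2 = w.count true % 2 := by
  induction d generalizing a w with
  | nil =>
    simp only [run, Multiset.mem_singleton] at h
    rw [h]
  | cons s d ih =>
    obtain ⟨rfl, hd⟩ := hd
    obtain ⟨x, hx, hx'⟩ := Multiset.mem_bind.1 h
    rw [ih hd (Slice.length_of_mem_colour hw hx) hx']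
    obtain ⟨u, v, v', z, rfl, rfl, hv, -⟩ := Slice.exists_of_mem_colour hw hx
    have := Piece.count_of_mem_colour hv
    simp only [List.count_append]
    omega

theorem run_longKnot {f : List Slice} (hf : IsTangle [true] f [true]) (x : Bool) :
    run f [x] = Multiset.replicate (run f [x]).card [x] := by
  refine Multiset.eq_replicate_card.2 fun v hv => ?_
  have h₁ := length_of_mem_run (w := [x]) hf rfl hv
  have h₂ := count_of_mem_run (w := [x]) hf rfl hv
  match v, h₁ with
  | [y], _ =>
    cases x <;> cases y <;> simp_all

theorem card_run_closure {f : List Slice} (hf : IsTangle [true] f [true]) :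
    (run (closure f) []).card = (run f [false]).card + (run f [true]).card := by
  have key : ∀ x, (run (pad [] [false] f ++ [⟨[], .cap true, []⟩]) [x, x]).card =
      (run f [x]).card := by
    intro x
    have h := run_pad [] [false] hf (u := []) (v := [x]) (w := [x]) rfl rfl
    simp only [List.nil_append, List.cons_append] at h
    rw [run_append, h, run_longKnot hf x]
    cases x <;> simp [run, Slice.colour, Piece.colour, Piece.bottom]
  have h : run (closure f) [] = run (pad [] [false] f ++ [⟨[], .cap true, []⟩]) [false, false] +
      run (pad [] [false] f ++ [⟨[], .cap true, []⟩]) [true, true] := by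
    simp [closure, run, Slice.colour, Piece.colour, Piece.bottom]
  rw [h, Multiset.card_add, key, key]

/-- The closure of a diagram on one strand is a knot diagram if and only if the colour of the strand
determines the colouring. -/
theorem isKnotDiagram_closure_iff {f : List Slice} (hf : IsTangle [true] f [true]) :
    IsKnotDiagram (closed hf) ↔ ∀ x, run f [x] = {[x]} := by
  have h := isKnotDiagram_iff (closed hf)
  rw [closed, card_run_closure hf] at h
  refine h.trans ?_
  constructor
  · intro h x
    have hpos : ∀ x, 0 < (run f [x]).card := fun x =>
      Multiset.card_pos_iff_exists_mem.2 ⟨_, replicate_mem_run x hf⟩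
    have h₁ := hpos false
    have h₂ := hpos true
    rw [run_longKnot hf x]
    have : (run f [x]).card = 1 := by cases x <;> omega
    rw [this, Multiset.replicate_one]
  · intro h
    simp [h]

theorem isKnotDiagram_closure_append {f g : List Slice} (hf : IsTangle [true] f [true])
    (hg : IsTangle [true] g [true]) (hf' : IsKnotDiagram (closed hf))
    (hg' : IsKnotDiagram (closed hg)) :
    IsKnotDiagram (closed (hf.append hg)) := by
  rw [isKnotDiagram_closure_iff] at *
  intro x
  simp [run_append, hf', hg']

/-! ### Invariance under equivalence of diagrams -/

theorem isKnotDiagram_congr {D D' : Tangle [] []} (h : Relation.EqvGen Step D D') :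
    IsKnotDiagram D ↔ IsKnotDiagram D' := by
  induction h with
  | rel x y h => rw [isKnotDiagram_iff, isKnotDiagram_iff, run_eq_of_step h rfl]
  | refl x => rfl
  | symm x y _ ih => exact ih.symm
  | trans x y z _ _ ih₁ ih₂ => exact ih₁.trans ih₂

/-- The long knot can be inserted on the boundary of the part that the step changes. -/
theorem insert_iso_of_step {g : List Slice} (hg : IsTangle [true] g [true]) {D D' : Tangle [] []}
    (h : Step D D') (hD : IsKnotDiagram D) (hD' : IsKnotDiagram D') {p p' : Point}
    (hp : p.On D.1) (hp' : p'.On D'.1) : Iso [] [] (p.insert g) (p'.insert g) := by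
  obtain ⟨t, t', hm, hr⟩ := h
  obtain ⟨a, b, ht, ht', hne, hab⟩ := boundary_of_move hm
  obtain ⟨q, q', hq, hq', hqq⟩ := exists_point_of_replace ht ht' (.inl hne) hab D.2 D'.2 hr
  have h₁ := Point.insert_iso_of_eqvGen hg (hD.2 p q hp hq) hp D.2
  have h₂ := Point.insert_iso_of_eqvGen hg (hD'.2 q' p' hq' hp') hq' D'.2
  exact h₁.trans (.trans ⟨h₁.right, h₂.left, .rel _ _ ⟨t, t', hm, hqq g⟩⟩ h₂)

/-- Insertion of a long knot into a knot diagram is well defined up to equivalence: neither the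
point of insertion nor the diagram of the knot matters. -/
theorem insert_iso {g : List Slice} (hg : IsTangle [true] g [true]) {D D' : Tangle [] []}
    (h : Relation.EqvGen Step D D') (hD : IsKnotDiagram D) {p p' : Point}
    (hp : p.On D.1) (hp' : p'.On D'.1) : Iso [] [] (p.insert g) (p'.insert g) := by
  induction h generalizing p p' with
  | rel x y h => exact insert_iso_of_step hg h hD ((isKnotDiagram_congr (.rel _ _ h)).1 hD) hp hp'
  | refl x => exact Point.insert_iso_of_eqvGen hg (hD.2 p p' hp hp') hp x.2
  | symm x y h ih => exact (ih ((isKnotDiagram_congr h).2 hD) hp' hp).symm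
  | trans x y z h₁ _ ih₁ ih₂ =>
    have hy := (isKnotDiagram_congr h₁).1 hD
    obtain ⟨q, hq⟩ := hy.1
    exact (ih₁ hD hp hq).trans (ih₂ hy hq hp')

/-- The point of the closure of `f` above `f`. -/
def topPoint (f : List Slice) : Point :=
  ⟨⟨[], .cup true, []⟩ :: pad [] [false] f, [], true, [false], [⟨[], .cap true, []⟩]⟩

/-- The point of the closure of `f` below `f`. -/
def bottomPoint (f : List Slice) : Point :=
  ⟨[⟨[], .cup true, []⟩], [], true, [false], pad [] [false] f ++ [⟨[], .cap true, []⟩]⟩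

theorem topPoint_on {f : List Slice} (hf : IsTangle [true] f [true]) :
    (topPoint f).On (closure f) :=
  ⟨by simp [topPoint, closure], rfl, hf.padded [] [false]⟩

theorem bottomPoint_on (f : List Slice) : (bottomPoint f).On (closure f) :=
  ⟨by simp [bottomPoint, closure], rfl, rfl⟩

theorem topPoint_insert (f g : List Slice) : (topPoint f).insert g = closure (f ++ g) := by
  simp [topPoint, Point.insert, closure, orient]

theorem bottomPoint_insert (f g : List Slice) : (bottomPoint f).insert g = closure (g ++ f) := by
  simp [bottomPoint, Point.insert, closure, orient]

/-- Every nonempty diagram without boundary can be cut open to a diagram on one strand. -/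
theorem exists_closure_iso {D : List Slice} (hD : IsTangle [] D []) (hne : D ≠ []) :
    ∃ f, IsTangle [true] f [true] ∧ Iso [] [] D (closure f) := by
  obtain ⟨d, hd, h⟩ : ∃ d, IsTangle [true, false] d [] ∧
      Iso [] [] D (⟨[], .cup true, []⟩ :: d) := by
    match D, hne, hD with
    | ⟨l, g, r⟩ :: d, _, hD =>
      have hD' := hD
      obtain ⟨h, hd⟩ := hD'
      simp only [Slice.bottom, List.append_eq_nil_iff] at h
      obtain ⟨⟨rfl, h⟩, rfl⟩ := h
      cases g with
      | cup a =>
        cases a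
        · exact ⟨⟨[], .cross true true false, []⟩ :: d, ⟨rfl, hd⟩,
            ((Iso.cup_cross true true).symm.append_right hd)⟩
        · exact ⟨d, hd, Iso.refl hD⟩
      | cap a => simp [Piece.bottom] at h
      | cross o a b => simp [Piece.bottom] at h
  have hd' : IsTangle [true, false, true] (pad [] [true] d) [true] := hd.padded [] [true]
  -- Cut the left leg of the lowest minimum, and bend the end of its right leg upwards.
  refine ⟨⟨[true], .cup false, []⟩ :: pad [] [true] d, ⟨rfl, hd'⟩, h.trans ?_⟩
  have h₁ := (Iso.exchange [] hd (s := [⟨[], .cap true, []⟩]) (c := [true, false]) (d := [])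
    ⟨rfl, rfl⟩).append_left
    (e := [⟨[], .cup true, []⟩, ⟨[true], .cup false, [false]⟩]) (a := []) ⟨rfl, rfl, rfl⟩
  have h₂ := (Iso.zagzig false).within [true] [] (A := [⟨[], .cup true, []⟩]) (B := d) (x := [])
    (y := []) (by exact ⟨rfl, rfl⟩) hd
  simp only [closure, pad_cons, pad_nil, pad_pad, pad_empty, Bool.not_false, List.cons_append,
    List.nil_append, List.append_nil] at h₁ h₂ ⊢
  exact (h₁.trans h₂).symm

/-! ### Connected sums of knots -/

theorem KnotDiagram.knot_eq_iff {D D' : KnotDiagram} :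
    D.knot = D'.knot ↔ Iso [] [] D.1.1 D'.1.1 :=
  ⟨fun h => ⟨D.1.2, D'.1.2, Quotient.exact h⟩, fun h => Quotient.sound h.2.2⟩

theorem Presents.isKnotDiagram {f : Tangle [true] [true]} {K : Knot} (h : Presents f K) :
    IsKnotDiagram (closed f.2) := by
  obtain ⟨D, hD, -⟩ := h
  have : closed f.2 = D.1 := Subtype.ext hD.symm
  exact this ▸ D.2

theorem Presents.iso {f : Tangle [true] [true]} {D : KnotDiagram} (h : Presents f D.knot) :
    Iso [] [] D.1.1 (closure f.1) := by
  obtain ⟨E, hE, h⟩ := h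
  exact hE ▸ KnotDiagram.knot_eq_iff.1 h.symm

theorem exists_presents (K : Knot) : ∃ f, Presents f K := by
  obtain ⟨D, rfl⟩ : ∃ D : KnotDiagram, D.knot = K := Quotient.exists_rep K
  obtain ⟨⟨p, hp⟩, -⟩ := D.2
  have hne : D.1.1 ≠ [] := by
    intro h
    obtain ⟨h₁, h₂⟩ := hp
    rw [h] at h₁
    rw [(List.append_eq_nil_iff.1 h₁.symm).1] at h₂
    simp [IsTangle] at h₂
  obtain ⟨f, hf, h⟩ := exists_closure_iso D.1.2 hne
  exact ⟨⟨f, hf⟩, ⟨closed hf, (isKnotDiagram_congr h.2.2).1 D.2⟩, rfl,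
    KnotDiagram.knot_eq_iff.2 h.symm⟩

theorem Presents.unique {f : Tangle [true] [true]} {K L : Knot} (hK : Presents f K)
    (hL : Presents f L) : K = L := by
  obtain ⟨D, hD, rfl⟩ := hK
  obtain ⟨E, hE, rfl⟩ := hL
  exact congrArg KnotDiagram.knot (Subtype.ext (Subtype.ext (hD.trans hE.symm)))

/-- The concatenation of two diagrams on one strand. -/
def Tangle.comp (f g : Tangle [true] [true]) : Tangle [true] [true] :=
  ⟨f.1 ++ g.1, f.2.append g.2⟩

theorem exists_presents_comp {f g : Tangle [true] [true]} {K L : Knot} (hf : Presents f K)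
    (hg : Presents g L) : ∃ S, Presents (f.comp g) S :=
  ⟨_, ⟨_, isKnotDiagram_closure_append f.2 g.2 hf.isKnotDiagram hg.isKnotDiagram⟩, rfl, rfl⟩

theorem isConnectedSum_iff {K L S : Knot} :
    IsConnectedSum K L S ↔ ∃ f g, Presents f K ∧ Presents g L ∧ Presents (f.comp g) S :=
  Iff.rfl

/-- Concatenation with `g` inserts `g` into the closure, so it depends on the closure only. -/
theorem Presents.comp_congr_left {f f' g : Tangle [true] [true]} {K L S : Knot}
    (hf : Presents f K) (hf' : Presents f' K) (hg : Presents g L) (h : Presents (f.comp g) S) :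
    Presents (f'.comp g) S := by
  obtain ⟨S', hS'⟩ := exists_presents_comp hf' hg
  obtain ⟨D, rfl⟩ : ∃ D : KnotDiagram, D.knot = K := Quotient.exists_rep K
  have h₁ := insert_iso g.2 (hf.iso.symm.trans hf'.iso).2.2 hf.isKnotDiagram (topPoint_on f.2)
    (topPoint_on f'.2)
  rw [topPoint_insert, topPoint_insert] at h₁
  obtain ⟨E, hE, rfl⟩ := h
  obtain ⟨E', hE', rfl⟩ := hS'
  refine ⟨E', hE', KnotDiagram.knot_eq_iff.2 ?_⟩
  rw [hE, hE']
  exact h₁.symm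

/-- Both concatenations insert `g` into the closure of `f`, above and below `f`. -/
theorem Presents.comp_comm {f g : Tangle [true] [true]} {K L S : Knot} (hf : Presents f K)
    (hg : Presents g L) (h : Presents (f.comp g) S) : Presents (g.comp f) S := by
  obtain ⟨S', hS'⟩ := exists_presents_comp hg hf
  have h₁ := insert_iso g.2 (.refl _) hf.isKnotDiagram (topPoint_on f.2) (bottomPoint_on f.1)
  rw [topPoint_insert, bottomPoint_insert] at h₁
  obtain ⟨E, hE, rfl⟩ := h
  obtain ⟨E', hE', rfl⟩ := hS'
  refine ⟨E', hE', KnotDiagram.knot_eq_iff.2 ?_⟩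
  rw [hE, hE']
  exact h₁.symm

theorem IsConnectedSum.comm {K L S : Knot} (h : IsConnectedSum K L S) : IsConnectedSum L K S := by
  obtain ⟨f, g, hf, hg, h⟩ := isConnectedSum_iff.1 h
  exact isConnectedSum_iff.2 ⟨g, f, hg, hf, hf.comp_comm hg h⟩

theorem IsConnectedSum.presents {K L S : Knot} (h : IsConnectedSum K L S)
    {f g : Tangle [true] [true]} (hf : Presents f K) (hg : Presents g L) :
    Presents (f.comp g) S := by
  obtain ⟨f', g', hf', hg', h⟩ := isConnectedSum_iff.1 h
  have h₁ := hf'.comp_congr_left hf hg' h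
  exact hg.comp_comm hf (hg'.comp_congr_left hg hf (hf.comp_comm hg' h₁))

theorem existsUnique_isConnectedSum (K L : Knot) : ∃! S, IsConnectedSum K L S := by
  obtain ⟨f, hf⟩ := exists_presents K
  obtain ⟨g, hg⟩ := exists_presents L
  obtain ⟨S, hS⟩ := exists_presents_comp hf hg
  exact ⟨S, isConnectedSum_iff.2 ⟨f, g, hf, hg, hS⟩, fun S' hS' =>
    (hS'.presents hf hg).unique hS⟩

/-- The connected sum of two knots. -/
noncomputable def Knot.sum (K L : Knot) : Knot := (existsUnique_isConnectedSum K L).choose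

theorem Knot.isConnectedSum_sum (K L : Knot) : IsConnectedSum K L (K.sum L) :=
  (existsUnique_isConnectedSum K L).choose_spec.1

theorem IsConnectedSum.eq_sum {K L S : Knot} (h : IsConnectedSum K L S) : S = K.sum L :=
  (existsUnique_isConnectedSum K L).unique h (Knot.isConnectedSum_sum K L)

theorem Knot.sum_comm (K L : Knot) : K.sum L = L.sum K :=
  (Knot.isConnectedSum_sum K L).comm.eq_sum

theorem Knot.sum_assoc (K L N : Knot) : (K.sum L).sum N = K.sum (L.sum N) := by
  obtain ⟨f, hf⟩ := exists_presents K
  obtain ⟨g, hg⟩ := exists_presents L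
  obtain ⟨h, hh⟩ := exists_presents N
  have h₁ := (isConnectedSum_sum (K.sum L) N).presents ((isConnectedSum_sum K L).presents hf hg) hh
  have h₂ := (isConnectedSum_sum K (L.sum N)).presents hf ((isConnectedSum_sum L N).presents hg hh)
  refine h₁.unique ?_
  have : (f.comp g).comp h = f.comp (g.comp h) := Subtype.ext (List.append_assoc _ _ _)
  rwa [this]

/-- The trivial knot, which is the closure of a single strand, is neutral. -/
theorem exists_sum_eq_self : ∃ U : Knot, ∀ K : Knot, K.sum U = K := by
  have hn : IsTangle [true] [] [true] := rfl
  have hU : IsKnotDiagram (closed hn) :=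
    (isKnotDiagram_closure_iff hn).2 fun x => rfl
  have hU' : Presents ⟨[], hn⟩ (KnotDiagram.knot ⟨_, hU⟩) := ⟨⟨_, hU⟩, rfl, rfl⟩
  refine ⟨KnotDiagram.knot ⟨_, hU⟩, fun K => ?_⟩
  obtain ⟨f, hf⟩ := exists_presents K
  have h := (Knot.isConnectedSum_sum K _).presents hf hU'
  have : f.comp ⟨[], hn⟩ = f := Subtype.ext (List.append_nil _)
  rw [this] at h
  exact h.unique hf

/-! ### Local moves and connected sums -/

/-- The insertion of a long knot at any point of a knot diagram presents the connected sum. -/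
theorem exists_knotDiagram_insert {D : KnotDiagram} {L : Knot} {g : Tangle [true] [true]}
    (hg : Presents g L) {p : Point} (hp : p.On D.1.1) :
    ∃ E : KnotDiagram, E.1.1 = p.insert g.1 ∧ E.knot = D.knot.sum L := by
  obtain ⟨f, hf⟩ := exists_presents D.knot
  obtain ⟨E, hE, hE'⟩ := (Knot.isConnectedSum_sum D.knot L).presents hf hg
  have h := insert_iso g.2 hf.iso.2.2 D.2 hp (topPoint_on f.2)
  rw [topPoint_insert] at h
  have hf' := (exists_presents_comp hf hg).choose_spec.isKnotDiagram
  refine ⟨⟨⟨p.insert g.1, h.left⟩, (isKnotDiagram_congr h.2.2).2 hf'⟩, rfl, ?_⟩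
  refine .trans (KnotDiagram.knot_eq_iff.2 ?_) hE'
  rw [hE]
  exact h

/-- A move of positive degree leaves room on its boundary for the second summand. -/
theorem MoveStep.sum {M : Set LocalMove} (hM : IsReduced M) {K K' : Knot} (h : MoveStep M K K')
    (L : Knot) : MoveStep M (K.sum L) (K'.sum L) := by
  obtain ⟨m, hm, D, D', rfl, rfl, hr⟩ := h
  obtain ⟨g, hg⟩ := exists_presents L
  have hpos := hM m hm
  have hb : m.fst.boundary ≠ [] := by
    intro h
    have := m.fst.length_boundary
    rw [h, List.length_nil] at this
    omega
  have ht' : IsTangle [] m.snd.diagram.1 m.fst.boundary := by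
    rw [m.boundary_eq]
    exact m.snd.diagram.2
  have hne : m.fst.diagram.1 ≠ [] := by
    intro h
    have := m.fst.diagram.2
    rw [h] at this
    exact hb this.symm
  obtain ⟨p, p', hp, hp', hpp⟩ := exists_point_of_replace m.fst.diagram.2 ht' (.inl hne) (.inr hb)
    D.1.2 D'.1.2 hr
  obtain ⟨E, hE, hEK⟩ := exists_knotDiagram_insert hg hp
  obtain ⟨E', hE', hEK'⟩ := exists_knotDiagram_insert hg hp'
  refine ⟨m, hm, E, E', hEK, hEK', ?_⟩
  rw [hE, hE']
  exact hpp g.1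

theorem eqvGen_moveStep_sum {M : Set LocalMove} (hM : IsReduced M) {K K' : Knot}
    (h : Relation.EqvGen (MoveStep M) K K') (L : Knot) :
    Relation.EqvGen (MoveStep M) (K.sum L) (K'.sum L) := by
  induction h with
  | rel x y h => exact .rel _ _ (h.sum hM L)
  | refl x => exact .refl _
  | symm x y _ ih => exact .symm _ _ ih
  | trans x y z _ _ ih₁ ih₂ => exact .trans _ _ _ ih₁ ih₂

/-- If the value on a connected sum depends only on the values on the summands, then the connected
sum descends to a commutative monoid structure on the values. -/
theorem isAdditive_of_sum_congr {X : Type*} {I : Knot → X} (hX : Function.Surjective I)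
    (h : ∀ K K' L, I K = I K' → I (K.sum L) = I (K'.sum L)) : IsAdditive I := by
  have h' : ∀ K K' L L', I K = I K' → I L = I L' → I (K.sum L) = I (K'.sum L') := by
    intro K K' L L' h₁ h₂
    rw [h K K' L h₁, K'.sum_comm L, K'.sum_comm L', h L L' K' h₂]
  obtain ⟨U, hU⟩ := exists_sum_eq_self
  let s : X → Knot := Function.surjInv hX
  have hs : ∀ x, I (s x) = x := Function.surjInv_eq hX
  have hadd : ∀ K L, I ((s (I K)).sum (s (I L))) = I (K.sum L) := fun K L =>
    h' _ _ _ _ (hs _) (hs _)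
  let _ : Add X := ⟨fun x y => I ((s x).sum (s y))⟩
  let _ : Zero X := ⟨I U⟩
  let inst : AddCommMonoid X :=
    { add_assoc := by
        intro x y z
        obtain ⟨K, rfl⟩ := hX x
        obtain ⟨L, rfl⟩ := hX y
        obtain ⟨N, rfl⟩ := hX z
        change I ((s (I ((s (I K)).sum (s (I L))))).sum (s (I N))) =
          I ((s (I K)).sum (s (I ((s (I L)).sum (s (I N))))))
        rw [hadd K L, hadd L N, hadd, hadd, Knot.sum_assoc]
      zero_add := by
        intro x
        obtain ⟨K, rfl⟩ := hX x
        change I ((s (I U)).sum (s (I K))) = I K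
        rw [hadd, Knot.sum_comm, hU]
      add_zero := by
        intro x
        obtain ⟨K, rfl⟩ := hX x
        change I ((s (I K)).sum (s (I U))) = I K
        rw [hadd, hU]
      add_comm := by
        intro x y
        change I ((s x).sum (s y)) = I ((s y).sum (s x))
        rw [Knot.sum_comm]
      nsmul := nsmulRec }
  refine ⟨inst, fun K L S hS => ?_⟩
  rw [hS.eq_sum]
  exact (hadd K L).symm

end SkeinKnot

theorem mainTheorem1 {X : Type*} (I : SkeinKnot.Knot → X)
    (hI : SkeinKnot.IsReducedSkeinInvariant I) (hX : Function.Surjective I) :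
    (∀ K K' : SkeinKnot.Knot, ∃! S : SkeinKnot.Knot, SkeinKnot.IsConnectedSum K K' S) ∧
      SkeinKnot.IsAdditive I := by
  refine ⟨SkeinKnot.existsUnique_isConnectedSum, ?_⟩
  obtain ⟨M, -, hM, f, hf, hIf⟩ := hI
  refine SkeinKnot.isAdditive_of_sum_congr hX fun K K' L h => ?_
  rw [hIf, hIf] at h ⊢
  exact congrArg f (Quotient.sound (SkeinKnot.eqvGen_moveStep_sum hM (Quotient.exact (hf h)) L))
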